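/- **Setting.** Let $G=(V,E)$ be a finite simple graph with $V=\{1,\dots,n\}$, $n\ge 1$, let $\Sigma$ be a finite non-empty alphabet, and let $\phi_v:\Sigma\to[0,\infty)$ ($v\in V$) and $\psi_{uv}:\Sigma^2\to[0,\infty)$ ($(u,v)\in E$) be the potentials of a pairwise Markov random field on $G$, with partition function $$Z=\sum_{x\in\Sigma^n}\exp\Big(\sum_{v\in V}\phi_v(x_v)+\sum_{(u,v)\in E}\psi_{uv}(x_u,x_v)\Big).$$ Let $d_G$ be the shortest path metric ($\infty$ between different components) and $B(v,r)=\{u: d_G(u,v)<r\}$. The *doubling dimension* of $G$ is the least $k\in\mathbb N$ such that for all $v\in V$ and $r\ge 0$ the ball $B(v,r)$ is covered by at most $2^{k}$ balls of radius $r/2$. **Decomposition.** For $p\in(0,1)$ and an integer $K\geq 1$ let $\mathbf Q$ have the law $\Pr[\mathbf Q=i]=p(1-p)^{i-1}$ for $1\le i<K$ and $\Pr[\mathbf Q=K]=(1-p)^{K-1}$. *Db-dim*$(p,K)$ on a graph $H$: initially all vertices are white; while there are white vertices, choose a white vertex $u$ uniformly at random, draw an independent copy $Q$ of $\mathbf Q$,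 colour blue the white vertices $w$ with $d_H(u,w)=Q$ and red those with $d_H(u,w)<Q$. The output is the set of blue vertices. **Log Partition.** Run Db-dim$(p,K)$ on the graph of the edges of $G$ (its vertices are the edges of $G$, two distinct ones adjacent when they share an end point) to obtain $\mathcal B\subset E$. Let $S_1,\dots,S_m$ be the connected components of $(V,E\setminus\mathcal B)$, let $Z_j$ be the partition function restricted to the nodes of $S_j$ and the edges of $E\setminus \mathcal B$ inside $S_j$, computed exhaustively, and let $\psi^L_{uv}$ and $\psi^U_{uv}$ be the minimum and the maximum of $\psi_{uv}$. Output $$\log\hat Z_{LB}=\sum_j\log Z_j+\sum_{(u,v)\in\mathcal B}\psi^L_{uv},\qquad \log\hat Z_{UB}=\sum_j\log Z_j+\sum_{(u,v)\in\mathcal B}\psi^U_{uv}.$$ Time is the number of elementary steps, in the worst case over the random choices, of the following implementation on a random access machine with unit-cost exact real arithmetic. The input is given by adjacency lists and potential tables; vertex sets are kept as arrays of marks; distances and components are found by breadth first search; a uniform choice costs one step and a draw of $\mathbf Q$ costs $K$ steps; and each $Z_j$ is summed over all assignments of its component. **Theorem.** Let $\rho\in\mathbb N$ and $\varepsilon\in(0,1)$,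 suppose that $G$ has doubling dimension at most $\rho$, and put $$\varphi=\varepsilon 2^{-\rho-3},\qquad K(\varphi,\rho)=\frac{12\rho}{\varphi}\log\frac{24\rho}{\varphi}\quad(K(\varphi,0)=0).$$ Run Log Partition with Db-dim$(\varphi,K)$, where $K$ is $K(\varphi,\rho)$ rounded to an integer, either down or up. (If $\rho=0$, then $G$ has no edges, nothing is drawn, and $\mathcal B=\emptyset$.) Then: 1. The implementation returns exactly the random pair $(\log\hat Z_{LB},\log\hat Z_{UB})$ described above (equality in law); with probability one $\log\hat Z_{LB}\le\log Z\le\log\hat Z_{UB}$; and $$\mathbb E\big[\log\hat Z_{UB}-\log\hat Z_{LB}\big]\le\varepsilon\log Z .$$ 2. If $|\Sigma|\ge 2$, the running time is $O\big(n\,2^\rho\,|\Sigma|^{K(\varphi,\rho)^{2\rho}}\big)$, with an absolute constant (and the convention $0^0=1$). 3. For a fixed alphabet $\Sigma$ and any sequence of instances $(G_i,\rho_i,\varepsilon_i)$ as above with numbers of nodes $n_i\to\infty$, if $\rho_i(\rho_i+\log(1/\varepsilon_i))=o(\log\log n_i)$, then the running time is $o(n_i^{1+\delta})$ for every $\delta>0$.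 -/

import Mathlib

open scoped ENNReal NNReal Asymptotics

/-! ### Step counting

`Timed α` is the result of a deterministic computation together with the number of elementary
steps it has used; `RandTimed α` is the law of such a result when the computation may also draw random
numbers.  The elementary steps are those of a random access machine with exact real arithmetic:
an arithmetic operation, comparison, `exp` or `log` of real numbers, reading or writing an array
cell, the next element of a list.  A `Finset` or the set of elements of a list is kept as an array
of marks, so that one membership test, insertion or deletion is one elementary step. -/

/-- A value and the number of elementary steps used to compute it. -/
structure Timed (α : Type) where
  val : α
  time : ℕ

namespace Timed

instance : Monad Timed where
  pure a := ⟨a, 0⟩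
  bind x f := ⟨(f x.val).val, x.time + (f x.val).time⟩

/-- `k` elementary steps. -/
def tick (k : ℕ) : Timed Unit := ⟨(), k⟩

/-- The loop `for a in l do b := f b a`; every round is charged one step for its bounded number of
elementary operations, and the steps that the body `f b a` charges itself. -/
def foldl {α β : Type} (f : β → α → Timed β) : β → List α → Timed β
  | b, [] => pure b
  | b, a :: l => do
      tick 1
      let b' ← f b a
      foldl f b' l

/-- The sum of `f a` over the list `l`, computed by a loop. -/
noncomputable def sumOver {α : Type} (l : List α) (f : α → Timed ℝ) : Timed ℝ :=
  foldl (fun s a => do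
    let y ← f a
    pure (s + y)) 0 l

/-- The entries of `l` that satisfy `p`, found by a loop. -/
def filter {α : Type} (p : α → Prop) [DecidablePred p] (l : List α) : Timed (List α) :=
  foldl (fun r a => pure (if p a then a :: r else r)) [] l

/-- The array with entries `f 0, …, f (n - 1)`, filled by a loop. -/
def table {n : ℕ} {β : Type} (f : Fin n → Timed β) : Timed (Fin n → β) :=
  ⟨fun v => (f v).val, ∑ v, ((f v).time + 1)⟩

end Timed

/-- The law of the outcome of a randomized computation: its value and its number of steps. -/
def RandTimed (α : Type) : Type := PMF (Timed α)

namespace RandTimed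

/-- The joint law of value and number of steps. -/
def law {α : Type} (m : RandTimed α) : PMF (Timed α) := m

noncomputable instance : Monad RandTimed where
  pure := fun {α} a => PMF.pure (⟨a, 0⟩ : Timed α)
  bind := fun {_ β} m f => PMF.bind (law m) fun x =>
    (law (f x.val)).map fun y => (⟨y.val, x.time + y.time⟩ : Timed β)

/-- A deterministic computation as a randomized one. -/
noncomputable def lift {α : Type} (x : Timed α) : RandTimed α := PMF.pure x

/-- A fresh independent random draw from `p`, charged `k` steps. -/
noncomputable def draw {α : Type} (p : PMF α) (k : ℕ) : RandTimed α := p.map fun a => (⟨a, k⟩ : Timed α)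

/-- The law of the output alone. -/
noncomputable def output {α : Type} (m : RandTimed α) : PMF α := (law m).map Timed.val

/-- The numbers of steps that occur with positive probability. -/
def runningTimes {α : Type} (m : RandTimed α) : Set ℕ := {t | ∃ r ∈ (law m).support, r.time = t}

end RandTimed

/-! ### Doubling dimension -/

section Doubling

variable {V : Type*}

/-- The open ball of radius `r` for the shortest path metric (`∞` between different components). -/
def graphBall (G : SimpleGraph V) (v : V) (r : ℝ) : Set V :=
  {u | ((G.edist u v : ℕ∞) : ℝ≥0∞) < ENNReal.ofReal r}

/-- The least `k` such that the ball of radius `r` at `v` is covered by `2 ^ k` balls of radius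
`r / 2`. -/
noncomputable def localDoublingDim (G : SimpleGraph V) (v : V) (r : ℝ) : ℕ∞ :=
  ⨅ (k : ℕ) (_ : ∃ u : Fin (2 ^ k) → V, graphBall G v r ⊆ ⋃ i, graphBall G (u i) (r / 2)), (k : ℕ∞)

/-- The doubling dimension of a graph. -/
noncomputable def doublingDim (G : SimpleGraph V) : ℕ∞ :=
  ⨆ (v : V) (r : ℝ≥0), localDoublingDim G v r

end Doubling

/-! ### The random decomposition `Db-dim` -/

/-- The weights of the truncated geometric law `𝐐` on `{1, …, K}`. -/
noncomputable def truncGeomWeight (p : ℝ) (K i : ℕ) : ℝ :=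
  if 1 ≤ i ∧ i < K then p * (1 - p) ^ (i - 1)
  else if i = K then (1 - p) ^ (K - 1) else 0

theorem truncGeomWeight_sum (p : ℝ) (h0 : 0 ≤ p) (h1 : p ≤ 1) (K : ℕ) (hK : 1 ≤ K) :
    ∑ i ∈ Finset.Icc 1 K, ENNReal.ofReal (truncGeomWeight p K i) = 1 := by
  have key : ∀ m : ℕ, ∑ i ∈ Finset.range m, p * (1 - p) ^ i + (1 - p) ^ m = 1 := by
    intro m
    induction m with
    | zero => simp
    | succ m ih => rw [Finset.sum_range_succ, pow_succ]; linarith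
  have h2 : (0 : ℝ) ≤ 1 - p := by linarith
  rw [← ENNReal.ofReal_sum_of_nonneg]
  · obtain ⟨m, rfl⟩ : ∃ m, K = m + 1 := ⟨K - 1, by omega⟩
    rw [← ENNReal.ofReal_one]
    congr 1
    rw [Finset.sum_Icc_succ_top (by omega)]
    have e1 : ∑ i ∈ Finset.Icc 1 m, truncGeomWeight p (m + 1) i
        = ∑ i ∈ Finset.range m, p * (1 - p) ^ i := by
      have e3 := Finset.sum_Ico_add' (fun i => p * (1 - p) ^ (i - 1)) 0 m 1
      simp only [Nat.add_sub_cancel] at e3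
      rw [Finset.range_eq_Ico, e3]
      refine Finset.sum_congr ?_ ?_
      · ext i; simp only [Finset.mem_Icc, Finset.mem_Ico]; omega
      · intro i hi
        rw [Finset.mem_Ico] at hi
        rw [truncGeomWeight, if_pos ⟨by omega, by omega⟩]
    have e2 : truncGeomWeight p (m + 1) (m + 1) = (1 - p) ^ m := by
      simp [truncGeomWeight]
    rw [e1, e2, key]
  · intro i _
    unfold truncGeomWeight
    split_ifs <;> positivity

/-- The law of `𝐐`: `Pr[𝐐 = i] = p (1 - p) ^ (i - 1)` for `1 ≤ i < K` and
`Pr[𝐐 = K] = (1 - p) ^ (K - 1)`.  (For `p ∉ [0, 1]` or `K = 0` there is no such law, and the value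
is irrelevant.) -/
noncomputable def truncGeom (p : ℝ) (K : ℕ) : PMF ℕ :=
  if h : 0 ≤ p ∧ p ≤ 1 ∧ 1 ≤ K then
    PMF.ofFinset
      (fun i => if i ∈ Finset.Icc 1 K then ENNReal.ofReal (truncGeomWeight p K i) else 0)
      (Finset.Icc 1 K)
      (by
        rw [Finset.sum_congr rfl fun i hi => if_pos hi]
        exact truncGeomWeight_sum p h.1 h.2.1 K h.2.2)
      (fun _ hi => if_neg hi)
  else PMF.pure 1

section Decomposition

variable {W : Type}

open Classical in
/-- The iterations of `Db-dim`, from the set `white` of white vertices and the set `B` of blue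
ones: while there is a white vertex, choose a uniformly random white vertex `u`, draw `Q`
independently, colour blue the white vertices at distance `Q` from `u` and red the white vertices
at distance `< Q`.  Distances are those of the whole graph.  The first argument bounds the number
of iterations. -/
noncomputable def dbDimLoop (H : SimpleGraph W) (p : ℝ) (K : ℕ) :
    ℕ → Finset W → Finset W → PMF (Finset W)
  | 0, _, B => PMF.pure B
  | t + 1, white, B =>
      if h : white.Nonempty then
        (PMF.uniformOfFinset white h).bind fun u =>
          (truncGeom p K).bind fun Q =>
            dbDimLoop H p K t
              (white.filter fun w => (Q : ℕ∞) < H.edist u w)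
              (B ∪ white.filter fun w => H.edist u w = (Q : ℕ∞))
      else PMF.pure B

/-- The law of the random set of vertices that `Db-dim(p, K)` returns on the graph `H` with vertex
set `V₀`.  Every iteration colours at least the chosen vertex, so `#V₀` iterations suffice. -/
noncomputable def dbDim (H : SimpleGraph W) (p : ℝ) (K : ℕ) (V₀ : Finset W) : PMF (Finset W) :=
  dbDimLoop H p K V₀.card V₀ ∅

end Decomposition

/-! ### Pairwise Markov random fields -/

/-- A pairwise Markov random field on the nodes `0, …, n - 1` with alphabet `{0, …, q - 1}` and
nonnegative potentials.  An edge `{u, v}` with `u < v` carries the potential `edgePot u v`. -/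
structure PairwiseMRF (n q : ℕ) where
  graph : SimpleGraph (Fin n)
  nodePot : Fin n → Fin q → ℝ
  edgePot : Fin n → Fin n → Fin q → Fin q → ℝ
  nodePot_nonneg : ∀ v a, 0 ≤ nodePot v a
  edgePot_nonneg : ∀ u v a b, u < v → graph.Adj u v → 0 ≤ edgePot u v a b

/-- The edge `{u, v}` as an ordered pair. -/
def mkEdge {n : ℕ} (u v : Fin n) : Fin n × Fin n := (min u v, max u v)

open Classical in
/-- The edges of a graph, each represented by the pair of its end points in increasing order. -/
noncomputable def edgePairs {n : ℕ} (G : SimpleGraph (Fin n)) : Finset (Fin n × Fin n) :=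
  Finset.univ.filter fun e => e.1 < e.2 ∧ G.Adj e.1 e.2

/-- The graph of the edges of `G`: two edges are adjacent when they share an end point.  (Pairs
that are not edges of `G` are isolated.) -/
def edgeGraph {n : ℕ} (G : SimpleGraph (Fin n)) : SimpleGraph (Fin n × Fin n) where
  Adj e f := e ≠ f ∧ e ∈ edgePairs G ∧ f ∈ edgePairs G ∧
    (e.1 = f.1 ∨ e.1 = f.2 ∨ e.2 = f.1 ∨ e.2 = f.2)
  symm := ⟨fun e f h => by
    obtain ⟨h1, h2, h3, h4⟩ := h
    refine ⟨h1.symm, h3, h2, ?_⟩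
    rcases h4 with h | h | h | h <;> simp [h]⟩
  loopless := ⟨fun e h => h.1 rfl⟩

/-- The graph `(V, E \ B)`. -/
def removeEdges {n : ℕ} (G : SimpleGraph (Fin n)) (B : Finset (Fin n × Fin n)) :
    SimpleGraph (Fin n) where
  Adj u v := G.Adj u v ∧ mkEdge u v ∉ B
  symm := ⟨fun u v h => by
    refine ⟨h.1.symm, ?_⟩
    have : mkEdge v u = mkEdge u v := by simp [mkEdge, min_comm, max_comm]
    rw [this]; exact h.2⟩
  loopless := ⟨fun u h => G.loopless.irrefl u h.1⟩

namespace PairwiseMRF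

variable {n q : ℕ}

/-- The partition function `Z`. -/
noncomputable def partitionFn (M : PairwiseMRF n q) : ℝ :=
  ∑ x : Fin n → Fin q,
    Real.exp (∑ v, M.nodePot v (x v) +
      ∑ e ∈ edgePairs M.graph, M.edgePot e.1 e.2 (x e.1) (x e.2))

/-- `ψ^L`, the minimum of the potential of the edge `e`. -/
noncomputable def edgeMin [NeZero q] (M : PairwiseMRF n q) (e : Fin n × Fin n) : ℝ :=
  Finset.univ.inf' Finset.univ_nonempty fun ab : Fin q × Fin q => M.edgePot e.1 e.2 ab.1 ab.2

/-- `ψ^U`, the maximum of the potential of the edge `e`. -/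
noncomputable def edgeMax [NeZero q] (M : PairwiseMRF n q) (e : Fin n × Fin n) : ℝ :=
  Finset.univ.sup' Finset.univ_nonempty fun ab : Fin q × Fin q => M.edgePot e.1 e.2 ab.1 ab.2

open Classical in
/-- The partition function restricted to the nodes in `S` and the edges of `(V, E \ B)` inside
`S`. -/
noncomputable def restrictedPartitionFn (M : PairwiseMRF n q) (B : Finset (Fin n × Fin n))
    (S : Finset (Fin n)) : ℝ :=
  ∑ x : S → Fin q,
    Real.exp (∑ v : S, M.nodePot v (x v) +
      ∑ u : S, ∑ v : S,
        if u < v ∧ (removeEdges M.graph B).Adj u v then M.edgePot u v (x u) (x v) else 0)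

open Classical in
/-- The vertex sets of the connected components `S₁, …, S_K` of `(V, E \ B)`. -/
noncomputable def components (M : PairwiseMRF n q) (B : Finset (Fin n × Fin n)) :
    Finset (Finset (Fin n)) :=
  Finset.univ.image fun v => Finset.univ.filter fun w => (removeEdges M.graph B).Reachable v w

/-- `log Ẑ_LB` for the set `B` of removed edges. -/
noncomputable def logLowerBound [NeZero q] (M : PairwiseMRF n q) (B : Finset (Fin n × Fin n)) : ℝ :=
  ∑ S ∈ M.components B, Real.log (M.restrictedPartitionFn B S) + ∑ e ∈ B, M.edgeMin e

/-- `log Ẑ_UB` for the set `B` of removed edges. -/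
noncomputable def logUpperBound [NeZero q] (M : PairwiseMRF n q) (B : Finset (Fin n × Fin n)) : ℝ :=
  ∑ S ∈ M.components B, Real.log (M.restrictedPartitionFn B S) + ∑ e ∈ B, M.edgeMax e

end PairwiseMRF

/-! ### The algorithms with their steps -/

section Search

variable {W : Type} [DecidableEq W]

/-- One round of breadth first search with adjacency lists `nbrs`: from the list of the visited
vertices and the list of those among them that were reached last, to the same after one more
level. -/
def bfsExpand (nbrs : W → List W) (st : List W × List W) : Timed (List W × List W) :=
  Timed.foldl (fun s w =>
      Timed.foldl (fun s x =>
          pure (if x ∈ s.1 then s else (x :: s.1, x :: s.2))) s (nbrs w))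
    (st.1, []) st.2

/-- At most `Q` rounds of breadth first search, ending early when nothing new was reached. -/
def bfs (nbrs : W → List W) : ℕ → List W × List W → Timed (List W × List W)
  | 0, st => pure st
  | Q + 1, st => do
      Timed.tick 1
      if st.2.isEmpty then pure st
      else do
        let st' ← bfsExpand nbrs st
        bfs nbrs Q st'

/-- The iterations of `Db-dim`, with adjacency lists `nbrs`.  The uniform choice of a white vertex
is charged one step; the draw of `Q` is charged `K` steps, which is enough to obtain it by tossing
at most `K - 1` coins of bias `p`.  The vertices at distance `≤ Q` and `= Q` from `u` are found by
breadth first search. -/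
noncomputable def dbDimRunLoop (nbrs : W → List W) (p : ℝ) (K : ℕ) :
    ℕ → Finset W → Finset W → RandTimed (Finset W)
  | 0, _, B => pure B
  | t + 1, white, B =>
      if h : white.Nonempty then do
        let u ← RandTimed.draw (PMF.uniformOfFinset white h) 1
        let Q ← RandTimed.draw (truncGeom p K) K
        let r ← RandTimed.lift (bfs nbrs Q ([u], [u]))
        let B' ← RandTimed.lift
          (Timed.foldl (fun B w => pure (if w ∈ white then insert w B else B)) B r.2)
        let white' ← RandTimed.lift (Timed.foldl (fun X w => pure (X.erase w)) white r.1)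
        dbDimRunLoop nbrs p K t white' B'
      else do
        RandTimed.lift (Timed.tick 1)
        pure B

/-- `Db-dim(p, K)` on the graph with the listed vertices and adjacency lists `nbrs`. -/
noncomputable def dbDimRun (nbrs : W → List W) (p : ℝ) (K : ℕ) (verts : List W) :
    RandTimed (Finset W) := do
  let white ← RandTimed.lift (Timed.foldl (fun X w => pure (insert w X)) ∅ verts)
  dbDimRunLoop nbrs p K white.card white ∅

end Search

namespace PairwiseMRF

variable {n q : ℕ}

open Classical in
/-- The adjacency lists of the graph, which are part of the input. -/
noncomputable def nbrs (M : PairwiseMRF n q) (u : Fin n) : List (Fin n) :=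
  (List.finRange n).filter fun v => M.graph.Adj u v

/-- The list of the edges, from the adjacency lists. -/
noncomputable def listEdges (M : PairwiseMRF n q) : Timed (List (Fin n × Fin n)) :=
  Timed.foldl (fun F u =>
      Timed.foldl (fun F v => pure (if u < v then (u, v) :: F else F)) F (M.nbrs u))
    [] (List.finRange n)

/-- The adjacency lists of the graph of the edges: the edges at the one and at the other end point
of `e`.  (They also contain `e` itself, which does not matter in a search that has reached `e`.)
An entry is obtained in a bounded number of elementary steps when it is scanned. -/
noncomputable def edgeNbrs (M : PairwiseMRF n q) (e : Fin n × Fin n) : List (Fin n × Fin n) :=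
  (M.nbrs e.1).map (mkEdge e.1) ++ (M.nbrs e.2).map (mkEdge e.2)

/-- The adjacency lists of `(V, E \ B)`. -/
noncomputable def pruneNbrs (M : PairwiseMRF n q) (B : Finset (Fin n × Fin n)) :
    Timed (Fin n → List (Fin n)) :=
  Timed.table fun u => Timed.filter (fun v => mkEdge u v ∉ B) (M.nbrs u)

/-- The edges inside a connected component with node list `C`, from adjacency lists. -/
def listComponentEdges (adj : Fin n → List (Fin n)) (C : List (Fin n)) :
    Timed (List (Fin n × Fin n)) :=
  Timed.foldl (fun F u =>
      Timed.foldl (fun F v => pure (if u < v then (u, v) :: F else F)) F (adj u))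
    [] C

/-- The weight of the assignment `x` on the nodes `C` and the edges `F`. -/
noncomputable def computeWeight (M : PairwiseMRF n q) (C : List (Fin n))
    (F : List (Fin n × Fin n)) (x : Fin n → Fin q) : Timed ℝ := do
  let a ← Timed.sumOver C fun v => pure (M.nodePot v (x v))
  let b ← Timed.sumOver F fun e => pure (M.edgePot e.1 e.2 (x e.1) (x e.2))
  Timed.tick 1
  pure (Real.exp (a + b))

/-- Exhaustive summation of the weight over all assignments that agree with `x` off the listed
nodes. -/
noncomputable def sumAssignments (weight : (Fin n → Fin q) → Timed ℝ) :
    List (Fin n) → (Fin n → Fin q) → Timed ℝ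
  | [], x => weight x
  | v :: L, x =>
      Timed.sumOver (List.finRange q) fun a => sumAssignments weight L (Function.update x v a)

/-- `∑ j, log Z_j` over the connected components of the graph with adjacency lists `adj`, each
`Z_j` by exhaustive computation.  The state of the loop consists of the nodes of the components
found so far and the sum over these components. -/
noncomputable def sumLogComponents [NeZero q] (M : PairwiseMRF n q) (adj : Fin n → List (Fin n)) :
    Timed ℝ := do
  let r ← Timed.foldl (fun (st : Finset (Fin n) × ℝ) v =>
      if v ∈ st.1 then pure st
      else do
        let c ← bfs adj n ([v], [v])
        let seen ← Timed.foldl (fun X w => pure (insert w X)) st.1 c.1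
        let F ← listComponentEdges adj c.1
        let z ← sumAssignments (M.computeWeight c.1 F) c.1 (fun _ => 0)
        Timed.tick 1
        pure (seen, st.2 + Real.log z))
    (∅, 0) (List.finRange n)
  pure r.2

/-- `ψ^L` of the edge `e`, by a scan of its table. -/
noncomputable def computeEdgeMin [NeZero q] (M : PairwiseMRF n q) (e : Fin n × Fin n) : Timed ℝ :=
  Timed.foldl (fun m a =>
      Timed.foldl (fun m b => pure (min m (M.edgePot e.1 e.2 a b))) m (List.finRange q))
    (M.edgePot e.1 e.2 0 0) (List.finRange q)

/-- `ψ^U` of the edge `e`, by a scan of its table. -/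
noncomputable def computeEdgeMax [NeZero q] (M : PairwiseMRF n q) (e : Fin n × Fin n) : Timed ℝ :=
  Timed.foldl (fun m a =>
      Timed.foldl (fun m b => pure (max m (M.edgePot e.1 e.2 a b))) m (List.finRange q))
    (M.edgePot e.1 e.2 0 0) (List.finRange q)

/-- The bounds `(log Ẑ_LB, log Ẑ_UB)` from the edge list `E` and the set `B` of removed edges. -/
noncomputable def computeBounds [NeZero q] (M : PairwiseMRF n q) (E : List (Fin n × Fin n))
    (B : Finset (Fin n × Fin n)) : Timed (ℝ × ℝ) := do
  let adj ← M.pruneNbrs B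
  let s ← M.sumLogComponents adj
  let R ← Timed.filter (fun e => e ∈ B) E
  let lo ← Timed.sumOver R M.computeEdgeMin
  let hi ← Timed.sumOver R M.computeEdgeMax
  Timed.tick 1
  pure (s + lo, s + hi)

/-- The algorithm `Log Partition`, with `Db-dim(p, K)` run on the graph of the edges as the
decomposition; the output is `(log Ẑ_LB, log Ẑ_UB)`. -/
noncomputable def logPartition [NeZero q] (M : PairwiseMRF n q) (p : ℝ) (K : ℕ) : RandTimed (ℝ × ℝ) := do
  let E ← RandTimed.lift M.listEdges
  let B ← dbDimRun M.edgeNbrs p K E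
  RandTimed.lift (M.computeBounds E B)

end PairwiseMRF

/-! ### Parameters -/

/-- `φ = ε 2 ^ (-ρ - 3)`. -/
noncomputable def dbPhi (ε : ℝ) (ρ : ℕ) : ℝ := ε * (2 : ℝ) ^ (-(ρ : ℝ) - 3)

/-- `K(φ, ρ) = (12 ρ / φ) log (24 ρ / φ)`, read as `0` for `ρ = 0`. -/
noncomputable def dbRadius (φ : ℝ) (ρ : ℕ) : ℝ := 12 * ρ / φ * Real.log (24 * ρ / φ)

/-- `k` is the real number `x ≥ 0` rounded down or up to an integer. -/
def IsRounding (k : ℕ) (x : ℝ) : Prop := k = ⌊x⌋₊ ∨ k = ⌈x⌉₊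

/-! Deleting the blue edges decouples the components of `(V, E \ B)`, so the sum of the `log Z_j` is
the logarithm of the partition function of that graph (`prod_restrictedPartitionFn`). Charging every
deleted edge its least or largest potential then bounds `Z` term by term from below or above. Minima
are nonnegative, so the gap is at most the sum of `ψ^U` over the deleted edges, and its mean is at
most the largest deletion probability times the sum of `ψ^U` over all edges. A greedy choice of an
assignment (`exists_assignment_sum_edgeMax_le`) bounds that last sum by `2 * 2 ^ ρ * log Z`, because
degrees are below `2 ^ ρ`. A deletion probability of at most `2 φ` therefore gives a gap of `ε / 2 *
log Z`.

The deletion probability is bounded in `dbDimLoop_blue_le`. The geometric law has no memory: the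
first centre whose radius reaches an edge stops exactly there with probability `p`. Truncation at
`K` spoils this only for centres at distance exactly `K`, each adding at most `(1 - p) ^ (K - 1)`.
Doubling leaves at most `(4 (K + 2)) ^ ρ` such centres (`card_edges_le_of_edist_le`), and `K` is so
large that the total is at most `φ` (`truncation_le`).

For the time, adjacent surviving edges have the same centre (`dbDimLoop_support_centre`). A
component therefore lies in one ball of radius `K + 1` and has at most `(2 (K + 2)) ^ ρ` nodes
(`card_component_le`), which bounds the exponent of the exhaustive summation; the polynomial factors
fit into the slack left by `K ^ (2 ρ)`. In the asymptotic regime `K ^ (2 ρ)` is eventually at most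
`√(log n)` by `radius_pow_le_exp`, and `n exp (c √(log n))` is `o(n ^ (1 + δ))`.

The law of the output and the set of running times are separate projections of one joint law.
Correctness uses the first, and the time bounds use it to know which edge sets can occur. -/

namespace Timed

/-! ### Values and step counts of deterministic loops. -/

variable {α β : Type}

@[simp] theorem pure_val (a : α) : (pure a : Timed α).val = a := rfl
@[simp] theorem pure_time (a : α) : (pure a : Timed α).time = 0 := rfl
@[simp] theorem bind_val (x : Timed α) (f : α → Timed β) : (x >>= f).val = (f x.val).val := rfl
@[simp] theorem bind_time (x : Timed α) (f : α → Timed β) :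
    (x >>= f).time = x.time + (f x.val).time := rfl
@[simp] theorem tick_time (k : ℕ) : (tick k).time = k := rfl

theorem foldl_nil (f : β → α → Timed β) (b : β) : foldl f b [] = pure b := rfl

theorem foldl_cons_val (f : β → α → Timed β) (b : β) (a : α) (l : List α) :
    (foldl f b (a :: l)).val = (foldl f (f b a).val l).val := rfl

theorem foldl_cons_time (f : β → α → Timed β) (b : β) (a : α) (l : List α) :
    (foldl f b (a :: l)).time = 1 + ((f b a).time + (foldl f (f b a).val l).time) := rfl

theorem foldl_time_le_sum (f : β → α → Timed β) (g : α → ℕ) (b : β) (l : List α)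
    (h : ∀ b, ∀ a ∈ l, (f b a).time ≤ g a) :
    (foldl f b l).time ≤ (l.map fun a => 1 + g a).sum := by
  induction l generalizing b with
  | nil => simp [foldl_nil]
  | cons a l ih =>
      rw [foldl_cons_time, List.map_cons, List.sum_cons]
      have h1 := h b a (by simp)
      have h2 := ih (f b a).val fun b' a' ha' => h b' a' (by simp [ha'])
      omega

theorem foldl_time_le (f : β → α → Timed β) (c : ℕ) (b : β) (l : List α)
    (h : ∀ b, ∀ a ∈ l, (f b a).time ≤ c) :
    (foldl f b l).time ≤ l.length * (1 + c) := by
  have := foldl_time_le_sum f (fun _ => c) b l h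
  simpa using this

theorem foldl_pure_time (g : β → α → β) (b : β) (l : List α) :
    (foldl (fun b a => pure (g b a)) b l).time = l.length := by
  induction l generalizing b with
  | nil => rfl
  | cons a l ih =>
    rw [foldl_cons_time, ih, List.length_cons, pure_time]
    omega

theorem sumOver_val (l : List α) (f : α → Timed ℝ) :
    (sumOver l f).val = (l.map fun a => (f a).val).sum := by
  have key : ∀ s : ℝ, (foldl (fun s a => do
      let y ← f a
      pure (s + y)) s l).val = s + (l.map fun a => (f a).val).sum := by
    induction l with
    | nil => intro s; simp [foldl_nil]
    | cons a l ih =>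
      intro s
      rw [foldl_cons_val, ih]
      simp [add_assoc]
  rw [sumOver, key, zero_add]

theorem sumOver_time_le (l : List α) (f : α → Timed ℝ) (c : ℕ) (h : ∀ a ∈ l, (f a).time ≤ c) :
    (sumOver l f).time ≤ l.length * (1 + c) :=
  foldl_time_le _ _ _ _ fun b a ha => by simpa using h a ha

theorem filter_val (p : α → Prop) [DecidablePred p] (l : List α) :
    (filter p l).val = (l.filter p).reverse := by
  have key : ∀ r : List α, (foldl (fun r a => (pure (if p a then a :: r else r) : Timed _)) r l).val
      = (l.filter p).reverse ++ r := by
    induction l with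
    | nil => intro r; simp [foldl_nil]
    | cons a l ih =>
      intro r
      rw [foldl_cons_val, ih]
      by_cases h : p a <;> simp [h]
  rw [filter, key, List.append_nil]

theorem filter_time (p : α → Prop) [DecidablePred p] (l : List α) :
    (filter p l).time = l.length := foldl_pure_time _ _ _

end Timed

/-! ### Breadth first search: correctness and time. -/

section Bfs

variable {W : Type} [DecidableEq W]

/-- Scanning one adjacency list in breadth first search. -/
theorem bfsExpand_inner_spec (l : List W) (vis fr : List W)
    (hv : vis.Nodup) (hf : fr.Nodup) (hsub : fr ⊆ vis) :
    let r := (Timed.foldl (fun (s : List W × List W) x =>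
      (pure (if x ∈ s.1 then s else (x :: s.1, x :: s.2)) : Timed _)) (vis, fr) l).val
    r.1.Nodup ∧ r.2.Nodup ∧ r.2 ⊆ r.1 ∧ (∀ x, x ∈ r.1 ↔ x ∈ vis ∨ x ∈ l) ∧
      (∀ x, x ∈ r.2 ↔ x ∈ fr ∨ (x ∉ vis ∧ x ∈ l)) ∧
      r.1.length + fr.length = vis.length + r.2.length := by
  induction l generalizing vis fr with
  | nil => simp [Timed.foldl_nil, hv, hf, hsub]
  | cons a l ih =>
    simp only [Timed.foldl_cons_val, Timed.pure_val]
    by_cases ha : a ∈ vis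
    · simp only [ha, if_true]
      obtain ⟨h1, h2, h3, h4, h5, h6⟩ := ih vis fr hv hf hsub
      refine ⟨h1, h2, h3, fun x => ?_, fun x => ?_, h6⟩
      · rw [h4 x, List.mem_cons]
        constructor
        · tauto
        · rintro (h | rfl | h) <;> tauto
      · rw [h5 x, List.mem_cons]
        constructor
        · tauto
        · rintro (h | ⟨h, rfl | h'⟩) <;> tauto
    · simp only [ha, if_false]
      obtain ⟨h1, h2, h3, h4, h5, h6⟩ := ih (a :: vis) (a :: fr)
        (List.nodup_cons.2 ⟨ha, hv⟩) (List.nodup_cons.2 ⟨fun h => ha (hsub h), hf⟩)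
        (List.cons_subset_cons a hsub)
      refine ⟨h1, h2, h3, fun x => ?_, fun x => ?_, by simp at h6; omega⟩
      · rw [h4 x, List.mem_cons, List.mem_cons]
        tauto
      · rw [h5 x, List.mem_cons, List.mem_cons, List.mem_cons]
        constructor
        · rintro ((rfl | h) | h) <;> tauto
        · rintro (h | ⟨h, rfl | h'⟩)
          · tauto
          · tauto
          · by_cases hx : x = a <;> tauto

theorem bfsExpand_outer_spec (nbrs : W → List W) (l : List W) (vis fr : List W)
    (hv : vis.Nodup) (hf : fr.Nodup) (hsub : fr ⊆ vis) :
    let r := (Timed.foldl (fun s w => Timed.foldl (fun (s : List W × List W) x =>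
      (pure (if x ∈ s.1 then s else (x :: s.1, x :: s.2)) : Timed _)) s (nbrs w)) (vis, fr) l).val
    r.1.Nodup ∧ r.2.Nodup ∧ r.2 ⊆ r.1 ∧ (∀ x, x ∈ r.1 ↔ x ∈ vis ∨ ∃ w ∈ l, x ∈ nbrs w) ∧
      (∀ x, x ∈ r.2 ↔ x ∈ fr ∨ (x ∉ vis ∧ ∃ w ∈ l, x ∈ nbrs w)) ∧
      r.1.length + fr.length = vis.length + r.2.length := by
  induction l generalizing vis fr with
  | nil => simp [Timed.foldl_nil, hv, hf, hsub]
  | cons a l ih =>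
    simp only [Timed.foldl_cons_val]
    obtain ⟨h1, h2, h3, h4, h5, h6⟩ := bfsExpand_inner_spec (nbrs a) vis fr hv hf hsub
    obtain ⟨k1, k2, k3, k4, k5, k6⟩ := ih _ _ h1 h2 h3
    rw [Prod.mk.eta] at k1 k2 k3 k4 k5 k6
    refine ⟨k1, k2, k3, fun x => ?_, fun x => ?_, by omega⟩
    · rw [k4 x, h4 x]; simp only [List.mem_cons, exists_eq_or_imp]; tauto
    · rw [k5 x, h5 x, h4 x]; simp only [List.mem_cons, exists_eq_or_imp]; tauto

theorem bfsExpand_spec (nbrs : W → List W) (vis fr : List W) (hv : vis.Nodup) :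
    let r := (bfsExpand nbrs (vis, fr)).val
    r.1.Nodup ∧ r.2.Nodup ∧ (∀ x, x ∈ r.1 ↔ x ∈ vis ∨ ∃ w ∈ fr, x ∈ nbrs w) ∧
      (∀ x, x ∈ r.2 ↔ x ∉ vis ∧ ∃ w ∈ fr, x ∈ nbrs w) ∧
      r.1.length = vis.length + r.2.length := by
  obtain ⟨h1, h2, -, h4, h5, h6⟩ :=
    bfsExpand_outer_spec nbrs fr vis [] hv List.nodup_nil (by simp)
  exact ⟨h1, h2, h4, fun x => (h5 x).trans (by simp), h6⟩

theorem bfsExpand_time_le (nbrs : W → List W) (vis fr : List W) (D : ℕ)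
    (hD : ∀ w ∈ fr, (nbrs w).length ≤ D) :
    (bfsExpand nbrs (vis, fr)).time ≤ fr.length * (1 + D) := by
  refine Timed.foldl_time_le _ _ _ _ fun b a ha => ?_
  rw [Timed.foldl_pure_time]
  exact hD a ha

theorem bfs_succ (nbrs : W → List W) (Q : ℕ) (st : List W × List W) :
    bfs nbrs (Q + 1) st = (do
      Timed.tick 1
      if st.2.isEmpty then pure st
      else do
        let st' ← bfsExpand nbrs st
        bfs nbrs Q st') := rfl

/-- An empty frontier is a fixed point of the expansion, so the early exit affects the time but not
the value. -/
theorem bfs_succ_val (nbrs : W → List W) (Q : ℕ) (st : List W × List W) :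
    (bfs nbrs (Q + 1) st).val = (bfs nbrs Q (bfsExpand nbrs st).val).val := by
  have hnil : ∀ (Q : ℕ) (vis : List W), (bfs nbrs Q (vis, [])).val = (vis, []) := by
    intro Q vis
    cases Q with
    | zero => rfl
    | succ Q => simp [bfs_succ]
  obtain ⟨vis, fr⟩ := st
  rw [bfs_succ]
  cases fr with
  | nil =>
    have : (bfsExpand nbrs (vis, [])).val = (vis, []) := rfl
    rw [this, hnil]
    simp
  | cons a fr => simp

/-- A new frontier is as long as the growth of the visited list, so final size minus initial size
plus the initial frontier bounds the number of vertices scanned. Each pays `1 + D` for its scan and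
one more step towards the round; the extra `1` covers a last round with empty frontier. -/
theorem bfs_time_le (nbrs : W → List W) (D : ℕ) (Q : ℕ) (vis fr : List W)
    (hD : ∀ w, (nbrs w).length ≤ D) (hv : vis.Nodup) :
    vis.length ≤ (bfs nbrs Q (vis, fr)).val.1.length ∧
    (bfs nbrs Q (vis, fr)).time ≤
      1 + (2 + D) * ((bfs nbrs Q (vis, fr)).val.1.length - vis.length + fr.length) := by
  induction Q generalizing vis fr with
  | zero => simp [bfs]
  | succ Q ih =>
    rw [bfs_succ_val, bfs_succ]
    obtain ⟨h1, h2, h3, h4, h5⟩ := bfsExpand_spec nbrs vis fr hv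
    have ht := bfsExpand_time_le nbrs vis fr D fun w _ => hD w
    obtain ⟨k1, k2⟩ := ih (bfsExpand nbrs (vis, fr)).val.1 (bfsExpand nbrs (vis, fr)).val.2 h1
    rw [Prod.mk.eta] at k1 k2
    refine ⟨by omega, ?_⟩
    cases fr with
    | nil => simp
    | cons a l =>
      simp only [Timed.bind_time, Timed.tick_time, List.isEmpty_cons, Bool.false_eq_true, if_false]
      set N := (bfs nbrs Q (bfsExpand nbrs (vis, a :: l)).val).val.1.length
      have e1 : N - (bfsExpand nbrs (vis, a :: l)).val.1.length +
        (bfsExpand nbrs (vis, a :: l)).val.2.length = N - vis.length := by omega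
      rw [e1] at k2
      rw [List.length_cons] at ht ⊢
      -- The last summand `l.length + 1` is at least one and pays for the tick of this round.
      have : (2 + D) * (N - vis.length + (l.length + 1))
        = (2 + D) * (N - vis.length) + (l.length + 1) * (1 + D) + (l.length + 1) := by ring
      omega

theorem SimpleGraph.edist_le_add_one_of_adj {V : Type*} (H : SimpleGraph V) {u w x : V}
    (h : H.Adj w x) : H.edist u x ≤ H.edist u w + 1 :=
  (H.edist_triangle).trans (add_le_add_right (SimpleGraph.edist_eq_one_iff_adj.2 h).le _)

theorem SimpleGraph.exists_adj_edist_eq_of_edist_eq_succ {V : Type*} (H : SimpleGraph V) {u x : V}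
    {j : ℕ} (h : H.edist u x = ((j + 1 : ℕ) : ℕ∞)) : ∃ w, H.Adj w x ∧ H.edist u w = j := by
  have hne : H.edist x u ≠ ⊤ := by
    rw [H.edist_comm, h]; exact ENat.natCast_ne_top _
  obtain ⟨p, hp⟩ := SimpleGraph.exists_walk_of_edist_ne_top hne
  rw [H.edist_comm, h] at hp
  cases p with
  | nil => exact absurd hp (by
      rw [SimpleGraph.Walk.length_nil]; exact_mod_cast (Nat.succ_ne_zero j).symm)
  | @cons _ w _ hadj q =>
    refine ⟨w, hadj.symm, le_antisymm ?_ ?_⟩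
    · rw [H.edist_comm]
      refine (SimpleGraph.edist_le q).trans ?_
      simp only [SimpleGraph.Walk.length_cons, Nat.cast_inj, Nat.add_right_cancel_iff] at hp
      rw [hp]
    · have := H.edist_le_add_one_of_adj (u := u) hadj.symm
      rw [h] at this
      push_cast at this
      exact (ENat.add_le_add_iff_right (by simp)).1 this

/-- Breadth first search finds the ball and the sphere of radius `Q`. -/
theorem bfs_spec (H : SimpleGraph W) (nbrs : W → List W) (u : W)
    (hn : ∀ w, H.Reachable u w → ∀ x, (x ∈ nbrs w ∨ x = w) ↔ (H.Adj w x ∨ x = w)) (Q : ℕ) :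
    let r := (bfs nbrs Q ([u], [u])).val
    r.1.Nodup ∧ (∀ x, x ∈ r.1 ↔ H.edist u x ≤ Q) ∧ (∀ x, x ∈ r.2 ↔ H.edist u x = Q) ∧
      r.2.Nodup ∧ r.2.length ≤ r.1.length := by
  -- The induction needs an arbitrary starting level `j`: the visited list is the ball of radius
  -- `j`, the frontier its sphere.
  have key : ∀ (Q j : ℕ) (vis fr : List W), vis.Nodup → (∀ x, x ∈ vis ↔ H.edist u x ≤ j) →
      (∀ x, x ∈ fr ↔ H.edist u x = j) → fr.Nodup → fr.length ≤ vis.length →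
      let r := (bfs nbrs Q (vis, fr)).val
      r.1.Nodup ∧ (∀ x, x ∈ r.1 ↔ H.edist u x ≤ (j + Q : ℕ)) ∧
        (∀ x, x ∈ r.2 ↔ H.edist u x = (j + Q : ℕ)) ∧
      r.2.Nodup ∧ r.2.length ≤ r.1.length := by
    intro Q
    induction Q with
    | zero => intro j vis fr h1 h2 h3 h4 h5; exact ⟨h1, h2, h3, h4, h5⟩
    | succ Q ih =>
      intro j vis fr h1 h2 h3 h4 h5
      rw [bfs_succ_val]
      obtain ⟨k1, k2, k3, k4, k5⟩ := bfsExpand_spec nbrs vis fr h1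
      have e4 : ∀ x, x ∈ (bfsExpand nbrs (vis, fr)).val.2 ↔ H.edist u x = (j + 1 : ℕ) := by
        intro x
        rw [k4 x, h2 x]
        constructor
        · rintro ⟨hx, w, hw, hxw⟩
          rw [h3] at hw
          have hr : H.Reachable u w := by
            rw [← SimpleGraph.edist_ne_top_iff_reachable, hw]; exact ENat.natCast_ne_top _
          rcases (hn w hr x).1 (Or.inl hxw) with h | rfl
          · refine le_antisymm ?_ ?_
            · have := H.edist_le_add_one_of_adj (u := u) h
              rw [hw] at this
              exact_mod_cast this
            · rw [not_le] at hx
              push_cast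
              exact Order.add_one_le_of_lt hx
          -- A vertex in its own adjacency list is harmless: it has been visited already.
          · exact absurd hw.le hx
        · intro hx
          obtain ⟨w, hadj, hw⟩ := H.exists_adj_edist_eq_of_edist_eq_succ hx
          refine ⟨?_, w, (h3 w).2 hw, ?_⟩
          · rw [hx, not_le]; exact_mod_cast Nat.lt_succ_self j
          · have hr : H.Reachable u w := by
              rw [← SimpleGraph.edist_ne_top_iff_reachable, hw]; exact ENat.natCast_ne_top _
            exact ((hn w hr x).2 (Or.inl hadj)).resolve_right hadj.ne'
      have e3 : ∀ x, x ∈ (bfsExpand nbrs (vis, fr)).val.1 ↔ H.edist u x ≤ (j + 1 : ℕ) := by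
        intro x
        have : x ∈ (bfsExpand nbrs (vis, fr)).val.1 ↔
            x ∈ vis ∨ x ∈ (bfsExpand nbrs (vis, fr)).val.2 := by
          rw [k3 x, k4 x]; tauto
        rw [this, h2 x, e4 x, Nat.cast_succ]
        constructor
        · rintro (h | h)
          · exact h.trans (by exact_mod_cast Nat.le_succ j)
          · exact h.le
        · intro h
          rcases h.lt_or_eq with h | h
          · left; exact Order.le_of_lt_add_one h
          · right; exact h
      have := ih (j + 1) _ _ k1 e3 e4 k2 (by omega)
      simpa only [Nat.add_right_comm j 1 Q, Nat.add_assoc] using this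
  have := key Q 0 [u] [u] (by simp)
    (by
      intro x
      rw [List.mem_singleton, Nat.cast_zero, nonpos_iff_eq_zero, SimpleGraph.edist_eq_zero_iff,
        eq_comm]) (by
      intro x
      rw [List.mem_singleton, Nat.cast_zero, SimpleGraph.edist_eq_zero_iff, eq_comm])
    (by simp) (by simp)
  simpa using this

end Bfs

/-! ### Output law and running times of randomized computations. -/

theorem PMF.bind_congr_of_mem_support {α β : Type*} (p : PMF α) (f g : α → PMF β)
    (h : ∀ a ∈ p.support, f a = g a) : p.bind f = p.bind g := by
  ext b
  rw [PMF.bind_apply, PMF.bind_apply]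
  refine tsum_congr fun a => ?_
  by_cases ha : a ∈ p.support
  · rw [h a ha]
  · rw [(p.apply_eq_zero_iff a).2 ha, zero_mul, zero_mul]

namespace RandTimed

variable {α β : Type}

theorem law_bind (m : RandTimed α) (f : α → RandTimed β) :
    law (m >>= f) = (law m).bind fun x =>
      (law (f x.val)).map fun y => (⟨y.val, x.time + y.time⟩ : Timed β) := rfl

theorem output_pure (a : α) : output (pure a : RandTimed α) = PMF.pure a := by
  change (PMF.pure _).map _ = _
  rw [PMF.pure_map]

theorem output_lift (x : Timed α) : output (lift x) = PMF.pure x.val := by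
  change (PMF.pure _).map _ = _
  rw [PMF.pure_map]

theorem output_draw (p : PMF α) (k : ℕ) : output (draw p k) = p := by
  change (p.map _).map _ = _
  rw [PMF.map_comp]
  exact PMF.map_id p

theorem output_bind (m : RandTimed α) (f : α → RandTimed β) :
    output (m >>= f) = (output m).bind fun a => output (f a) := by
  unfold output
  rw [law_bind, PMF.map_bind, PMF.bind_map]
  congr 1
  funext x
  rw [PMF.map_comp]
  rfl

theorem output_lift_bind (x : Timed α) (f : α → RandTimed β) :
    output (lift x >>= f) = output (f x.val) := by
  rw [output_bind, output_lift, PMF.pure_bind]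

theorem mem_support_pure {a : α} {r : Timed α} (h : r ∈ (law (pure a : RandTimed α)).support) :
    r = ⟨a, 0⟩ := by
  have : r ∈ (PMF.pure (⟨a, 0⟩ : Timed α)).support := h
  simpa using this

theorem mem_support_lift {x r : Timed α} (h : r ∈ (law (lift x)).support) : r = x := by
  have : r ∈ (PMF.pure x).support := h
  simpa using this

theorem mem_support_draw {p : PMF α} {k : ℕ} {r : Timed α} (h : r ∈ (law (draw p k)).support) :
    r.val ∈ p.support ∧ r.time = k := by
  have : r ∈ (p.map fun a => (⟨a, k⟩ : Timed α)).support := h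
  rw [PMF.mem_support_map_iff] at this
  obtain ⟨a, ha, rfl⟩ := this
  exact ⟨ha, rfl⟩

theorem mem_support_bind {m : RandTimed α} {f : α → RandTimed β} {r : Timed β}
    (h : r ∈ (law (m >>= f)).support) :
    ∃ x ∈ (law m).support, ∃ y ∈ (law (f x.val)).support, r.val = y.val ∧
      r.time = x.time + y.time := by
  rw [law_bind, PMF.mem_support_bind_iff] at h
  obtain ⟨x, hx, h⟩ := h
  rw [PMF.mem_support_map_iff] at h
  obtain ⟨y, hy, rfl⟩ := h
  exact ⟨x, hx, y, hy, rfl, rfl⟩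

theorem mem_support_lift_bind {x : Timed α} {f : α → RandTimed β} {r : Timed β}
    (h : r ∈ (law (lift x >>= f)).support) :
    ∃ y ∈ (law (f x.val)).support, r.val = y.val ∧ r.time = x.time + y.time := by
  obtain ⟨z, hz, y, hy, h1, h2⟩ := mem_support_bind h
  rw [mem_support_lift hz] at hy h2
  exact ⟨y, hy, h1, h2⟩

theorem val_mem_support_output {m : RandTimed α} {r : Timed α} (h : r ∈ (law m).support) :
    r.val ∈ (output m).support := by
  unfold output
  rw [PMF.mem_support_map_iff]
  exact ⟨r, h, rfl⟩

end RandTimed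

/-! ### Law and running time of the implementation of Db-dim. -/

/-- The bound is `K + 1` and not `K` because of the irrelevant value `1` that is used when `K = 0`;
this keeps later time bounds free of conditions on `p` and `K`. -/
theorem mem_support_truncGeom {p : ℝ} {K Q : ℕ} (h : Q ∈ (truncGeom p K).support) :
    1 ≤ Q ∧ Q ≤ K + 1 := by
  unfold truncGeom at h
  split_ifs at h with hc
  · have h' := Finset.mem_Icc.1 ((PMF.mem_support_ofFinset_iff _ _ _).1 h).1
    omega
  · simp at h
    omega

section

variable {W : Type} [DecidableEq W]

theorem Timed.foldl_insert_filter (white : Finset W) (l : List W) (B : Finset W) :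
    (Timed.foldl (fun B w => (pure (if w ∈ white then insert w B else B) : Timed _)) B l).val
      = B ∪ white.filter (· ∈ l) := by
  induction l generalizing B with
  | nil => simp [Timed.foldl_nil]
  | cons a l ih =>
    rw [Timed.foldl_cons_val, ih, Timed.pure_val]
    ext x
    by_cases ha : a ∈ white
    · simp only [ha, if_true, Finset.mem_union, Finset.mem_insert, Finset.mem_filter,
        List.mem_cons]
      constructor
      · rintro ((rfl | h) | h) <;> tauto
      · tauto
    · simp only [ha, if_false, Finset.mem_union, Finset.mem_filter, List.mem_cons]
      constructor
      · tauto
      · rintro (h | ⟨h, rfl | h'⟩) <;> tauto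

theorem Timed.foldl_erase_filter (l : List W) (white : Finset W) :
    (Timed.foldl (fun X w => (pure (X.erase w) : Timed (Finset W))) white l).val
      = white.filter (· ∉ l) := by
  induction l generalizing white with
  | nil => simp [Timed.foldl_nil]
  | cons a l ih =>
    rw [Timed.foldl_cons_val, ih, Timed.pure_val]
    ext x
    simp only [Finset.mem_filter, Finset.mem_erase, List.mem_cons, not_or]
    tauto

theorem Timed.foldl_insert_toFinset (l : List W) (X : Finset W) :
    (Timed.foldl (fun X w => (pure (insert w X) : Timed (Finset W))) X l).val
      = X ∪ l.toFinset := by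
  induction l generalizing X with
  | nil => simp [Timed.foldl_nil]
  | cons a l ih =>
    rw [Timed.foldl_cons_val, ih, Timed.pure_val, List.toFinset_cons, Finset.insert_union,
      Finset.union_insert]

/-- The implementation of the loop of `Db-dim` has the law of the loop. -/
theorem dbDimRunLoop_output (H : SimpleGraph W) (nbrs : W → List W) (V₀ : Finset W)
    (hn : ∀ u ∈ V₀, ∀ w, H.Reachable u w → ∀ x, (x ∈ nbrs w ∨ x = w) ↔ (H.Adj w x ∨ x = w))
    (p : ℝ) (K t : ℕ) (white B : Finset W) (hw : white ⊆ V₀) :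
    (dbDimRunLoop nbrs p K t white B).output = dbDimLoop H p K t white B := by
  induction t generalizing white B with
  | zero => exact RandTimed.output_pure B
  | succ t ih =>
    unfold dbDimRunLoop dbDimLoop
    split_ifs with h
    · rw [RandTimed.output_bind, RandTimed.output_draw]
      -- Only centres in the support matter: the adjacency lists are known to be right only for
      -- searches started in `V₀`.
      refine PMF.bind_congr_of_mem_support _ _ _ fun u hu => ?_
      rw [PMF.mem_support_uniformOfFinset_iff] at hu
      rw [RandTimed.output_bind, RandTimed.output_draw]
      congr 1
      funext Q
      rw [RandTimed.output_lift_bind, RandTimed.output_lift_bind, RandTimed.output_lift_bind]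
      obtain ⟨-, h2, h3, -, -⟩ := bfs_spec H nbrs u (hn u (hw hu)) Q
      rw [Timed.foldl_insert_filter, Timed.foldl_erase_filter, ih]
      · congr 1
        · ext x; simp only [Finset.mem_filter, h2, not_le]
        · ext x; simp only [Finset.mem_union, Finset.mem_filter, h3]
      · exact (Finset.filter_subset _ _).trans hw
    · rw [RandTimed.output_lift_bind, RandTimed.output_pure]

theorem dbDimRun_output (H : SimpleGraph W) (nbrs : W → List W) (verts : List W)
    (hn : ∀ u ∈ verts, ∀ w, H.Reachable u w → ∀ x, (x ∈ nbrs w ∨ x = w) ↔ (H.Adj w x ∨ x = w))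
    (p : ℝ) (K : ℕ) :
    (dbDimRun nbrs p K verts).output = dbDim H p K verts.toFinset := by
  unfold dbDimRun dbDim
  rw [RandTimed.output_lift_bind, Timed.foldl_insert_toFinset, Finset.empty_union]
  exact dbDimRunLoop_output H nbrs verts.toFinset (by simpa using hn) p K _ _ _ subset_rfl

/-- Here `c` pays for one search and for the two recolouring loops over its sphere and ball, `1 + K`
pays for the two draws, and the final `1` for the test that finds no white vertex. -/
theorem dbDimRunLoop_time_le (nbrs : W → List W) (V₀ : Finset W) (p : ℝ) (K c : ℕ)
    (hc : ∀ u ∈ V₀, ∀ Q ≤ K + 1, (bfs nbrs Q ([u], [u])).time +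
      ((bfs nbrs Q ([u], [u])).val.2.length + (bfs nbrs Q ([u], [u])).val.1.length) ≤ c)
    (t : ℕ) (white B : Finset W) (hw : white ⊆ V₀) :
    ∀ r ∈ (RandTimed.law (dbDimRunLoop nbrs p K t white B)).support,
      r.time ≤ t * (1 + K + c) + 1 := by
  induction t generalizing white B with
  | zero =>
    intro r hr
    rw [RandTimed.mem_support_pure hr]
    simp
  | succ t ih =>
    intro r hr
    unfold dbDimRunLoop at hr
    split_ifs at hr with h
    · obtain ⟨x1, hx1, r1, hr1, -, e1⟩ := RandTimed.mem_support_bind hr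
      obtain ⟨hu, hx1⟩ := RandTimed.mem_support_draw hx1
      rw [PMF.mem_support_uniformOfFinset_iff] at hu
      obtain ⟨x2, hx2, r2, hr2, -, e2⟩ := RandTimed.mem_support_bind hr1
      obtain ⟨hQ, hx2⟩ := RandTimed.mem_support_draw hx2
      obtain ⟨r3, hr3, -, e3⟩ := RandTimed.mem_support_lift_bind hr2
      obtain ⟨r4, hr4, -, e4⟩ := RandTimed.mem_support_lift_bind hr3
      obtain ⟨r5, hr5, -, e5⟩ := RandTimed.mem_support_lift_bind hr4
      rw [Timed.foldl_erase_filter] at hr5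
      have h5 := ih _ _ ((Finset.filter_subset _ _).trans hw) r5 hr5
      have hb := hc x1.val (hw hu) x2.val (mem_support_truncGeom hQ).2
      rw [Timed.foldl_pure_time] at e4 e5
      have : (t + 1) * (1 + K + c) = t * (1 + K + c) + (1 + K + c) := by ring
      omega
    · obtain ⟨r1, hr1, -, e1⟩ := RandTimed.mem_support_lift_bind hr
      rw [RandTimed.mem_support_pure hr1] at e1
      simp at e1
      omega

theorem dbDimRun_time_le (nbrs : W → List W) (verts : List W) (p : ℝ) (K c : ℕ)
    (hc : ∀ u ∈ verts, ∀ Q ≤ K + 1, (bfs nbrs Q ([u], [u])).time +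
      ((bfs nbrs Q ([u], [u])).val.2.length + (bfs nbrs Q ([u], [u])).val.1.length) ≤ c) :
    ∀ r ∈ (RandTimed.law (dbDimRun nbrs p K verts)).support,
      r.time ≤ verts.length * (2 + K + c) + 1 := by
  intro r hr
  obtain ⟨r1, hr1, -, e1⟩ := RandTimed.mem_support_lift_bind hr
  rw [Timed.foldl_insert_toFinset, Finset.empty_union] at hr1
  have h1 := dbDimRunLoop_time_le nbrs verts.toFinset p K c (by simpa using hc) _ _ _ subset_rfl
    r1 hr1
  rw [Timed.foldl_pure_time] at e1
  have h2 := Nat.mul_le_mul_right (1 + K + c) (List.toFinset_card_le verts)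
  have : verts.length * (2 + K + c) = verts.length * (1 + K + c) + verts.length := by ring
  omega

end

/-! ### Db-dim: the red clusters and the probability of turning blue. -/

theorem dbDimLoop_support_subset {W : Type} (H : SimpleGraph W) (p : ℝ) (K t : ℕ)
    (white B : Finset W) :
    ∀ B' ∈ (dbDimLoop H p K t white B).support, ∀ e,
      (e ∈ B → e ∈ B') ∧ (e ∈ B' → e ∈ B ∨ e ∈ white) := by
  classical
  induction t generalizing white B with
  | zero =>
    intro B' h e
    simp only [dbDimLoop, PMF.support_pure, Set.mem_singleton_iff] at h
    subst h
    tauto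
  | succ t ih =>
    intro B' h e
    unfold dbDimLoop at h
    split_ifs at h with hne
    · simp only [PMF.mem_support_bind_iff] at h
      obtain ⟨u, hu, Q, hQ, h⟩ := h
      obtain ⟨h1, h2⟩ := ih _ _ B' h e
      simp only [Finset.mem_union, Finset.mem_filter] at h1 h2
      tauto
    · simp only [PMF.support_pure, Set.mem_singleton_iff] at h
      subst h
      tauto

theorem dbDim_support_subset {W : Type} (H : SimpleGraph W) (p : ℝ) (K : ℕ) (V₀ B : Finset W)
    (h : B ∈ (dbDim H p K V₀).support) : B ⊆ V₀ := fun e he => by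
  simpa using (dbDimLoop_support_subset H p K _ _ _ B h e).2 he

/-- The red vertices have centres: adjacent red vertices have the same one, at distance at most
`K` from both. -/
theorem dbDimLoop_support_centre {W : Type} (H : SimpleGraph W) (p : ℝ) (K t : ℕ)
    (white B : Finset W) (ht : white.card ≤ t) :
    ∀ B' ∈ (dbDimLoop H p K t white B).support, ∃ c : W → W,
      (∀ e ∈ white, e ∉ B' → c e ∈ white ∧ H.edist (c e) e ≤ K) ∧
      (∀ e ∈ white, ∀ f ∈ white, e ∉ B' → f ∉ B' → H.Adj e f → c e = c f) := by
  classical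
  induction t generalizing white B with
  | zero =>
    intro B' h
    have : white = ∅ := by simpa using ht
    subst this
    exact ⟨id, by simp, by simp⟩
  | succ t ih =>
    intro B' h
    unfold dbDimLoop at h
    split_ifs at h with hne
    · simp only [PMF.mem_support_bind_iff] at h
      obtain ⟨u, hu, Q, hQ, h⟩ := h
      rw [PMF.mem_support_uniformOfFinset_iff] at hu
      obtain ⟨hQ1, hQ2⟩ := mem_support_truncGeom hQ
      -- The centre itself leaves the white set, being at distance `0`; so the bound `t` on the
      -- iterations still suffices.
      have hlt : (white.filter fun w => (Q : ℕ∞) < H.edist u w).card < white.card := by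
        refine Finset.card_lt_card (Finset.filter_ssubset.2 ⟨u, hu, ?_⟩)
        simp
      obtain ⟨c, hc1, hc2⟩ := ih _ _ (by omega) B' h
      have hblue : ∀ e ∈ white, e ∉ B' → ¬ (Q : ℕ∞) < H.edist u e → H.edist u e < Q := by
        intro e he heB hle
        refine lt_of_le_of_ne (not_lt.1 hle) fun heq => heB ?_
        refine (dbDimLoop_support_subset H p K _ _ _ B' h e).1 ?_
        simp [he, heq]
      -- A neighbour of a vertex at distance below `Q` is at distance at most `Q`, so it cannot stay
      -- white and get another centre later: the blue sphere separates.
      have hadj : ∀ e f, H.edist u e < Q → H.Adj e f → ¬ (Q : ℕ∞) < H.edist u f := by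
        intro e f he hef
        rw [not_lt]
        exact (H.edist_le_add_one_of_adj hef).trans (Order.add_one_le_of_lt he)
      refine ⟨fun e => if (Q : ℕ∞) < H.edist u e then c e else u, ?_, ?_⟩
      · intro e he heB
        by_cases hd : (Q : ℕ∞) < H.edist u e
        · simp only [hd, if_true]
          obtain ⟨h1, h2⟩ := hc1 e (by simp [he, hd]) heB
          exact ⟨(Finset.mem_filter.1 h1).1, h2⟩
        · simp only [hd, if_false]
          refine ⟨hu, ?_⟩
          -- Red means strictly closer than `Q ≤ K + 1`, which gives the radius `K`.
          have := (hblue e he heB hd).trans_le (Nat.cast_le.2 hQ2)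
          push_cast at this
          exact Order.le_of_lt_add_one this
      · intro e he f hf heB hfB hef
        by_cases hd : (Q : ℕ∞) < H.edist u e
        · by_cases hd' : (Q : ℕ∞) < H.edist u f
          · simp only [hd, hd', if_true]
            exact hc2 e (by simp [he, hd]) f (by simp [hf, hd']) heB hfB hef
          · exact absurd hd (hadj f e (hblue f hf hfB hd') hef.symm)
        · have hd' := hadj e f (hblue e he heB hd) hef
          simp only [hd, hd', if_false]
    · rw [Finset.not_nonempty_iff_eq_empty] at hne
      subst hne
      exact ⟨id, by simp, by simp⟩

/-- Integration against the truncated geometric law. -/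
theorem tsum_truncGeom_mul (p : ℝ) (h0 : 0 ≤ p) (h1 : p ≤ 1) (K : ℕ) (hK : 1 ≤ K)
    (g : ℕ → ℝ) (hg : ∀ i, 0 ≤ g i) :
    ∑' Q, truncGeom p K Q * ENNReal.ofReal (g Q) =
      ENNReal.ofReal (∑ i ∈ Finset.range K, truncGeomWeight p K (i + 1) * g (i + 1)) := by
  have h2 : 0 ≤ 1 - p := by linarith
  have hw : ∀ i, 0 ≤ truncGeomWeight p K i := by
    intro i
    unfold truncGeomWeight
    split_ifs <;> positivity
  have e1 : ∀ f : ℕ → ℝ≥0∞, ∑ i ∈ Finset.Icc 1 K, f i = ∑ i ∈ Finset.range K, f (i + 1) := by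
    intro f
    rw [Finset.range_eq_Ico, Finset.sum_Ico_add' f 0 K 1]
    rfl
  rw [tsum_eq_sum (s := Finset.Icc 1 K), e1, ENNReal.ofReal_sum_of_nonneg]
  · refine Finset.sum_congr rfl fun i hi => ?_
    rw [Finset.mem_range] at hi
    rw [ENNReal.ofReal_mul (hw _), truncGeom, dif_pos ⟨h0, h1, hK⟩, PMF.ofFinset_apply, if_pos]
    rw [Finset.mem_Icc]; omega
  · exact fun i _ => mul_nonneg (hw _) (hg _)
  · intro i hi
    rw [truncGeom, dif_pos ⟨h0, h1, hK⟩, PMF.ofFinset_apply, if_neg hi, zero_mul]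

theorem sum_range_geom (p : ℝ) (m : ℕ) :
    ∑ i ∈ Finset.range m, p * (1 - p) ^ i = 1 - (1 - p) ^ m := by
  induction m with
  | zero => simp
  | succ m ih => rw [Finset.sum_range_succ, ih, pow_succ]; ring

theorem truncGeomWeight_succ_of_lt (p : ℝ) {K i : ℕ} (h : i + 1 < K) :
    truncGeomWeight p K (i + 1) = p * (1 - p) ^ i := by
  rw [truncGeomWeight, if_pos ⟨by omega, h⟩, Nat.add_sub_cancel]

theorem truncGeomWeight_succ_self (p : ℝ) (m : ℕ) :
    truncGeomWeight p (m + 1) (m + 1) = (1 - p) ^ m := by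
  simp [truncGeomWeight]

/-- One iteration of `Db-dim` seen from a vertex at distance `d` of the chosen one: with `a` a
bound for the probability to become blue later, and `b` a bound for it now. -/
theorem sum_truncGeomWeight_mul_le (p : ℝ) (h0 : 0 ≤ p) (h1 : p ≤ 1) (K : ℕ) (hK : 1 ≤ K)
    (d : ℕ∞) (a b : ℝ) (ha : p ≤ a) (hab : a ≤ b) (hd : d = K → a + (1 - p) ^ (K - 1) ≤ b) :
    ∑ i ∈ Finset.range K, truncGeomWeight p K (i + 1) *
      (if ((i + 1 : ℕ) : ℕ∞) = d then 1 else if ((i + 1 : ℕ) : ℕ∞) < d then a else 0) ≤ b := by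
  have h2 : 0 ≤ 1 - p := by linarith
  obtain ⟨M, rfl⟩ : ∃ M, K = M + 1 := ⟨K - 1, by omega⟩
  by_cases hdK : d ≤ ((M + 1 : ℕ) : ℕ∞)
  · lift d to ℕ using ne_top_of_le_ne_top (ENat.natCast_ne_top _) hdK
    rw [Nat.cast_le] at hdK
    simp only [Nat.cast_inj, Nat.cast_lt]
    rcases Nat.eq_zero_or_pos d with rfl | hd0
    · refine (Finset.sum_eq_zero fun i _ => ?_).le.trans (by linarith)
      simp
    obtain ⟨m, rfl⟩ : ∃ m, d = m + 1 := ⟨d - 1, by omega⟩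
    have hmM : m ≤ M := by omega
    rw [← Finset.sum_subset (Finset.range_subset_range.2 hdK)]
    swap
    · intro i _ hi
      rw [Finset.mem_range] at hi
      rw [if_neg (by omega), if_neg (by omega), mul_zero]
    rw [Finset.sum_range_succ, if_pos rfl, mul_one]
    -- With `d = m + 1`, the radii below `d` have total weight `1 - (1 - p) ^ m`. For `d < K` the
    -- radius `d` adds `p (1 - p) ^ m ≤ a (1 - p) ^ m`, so the total is at most `a`. For `d = K` it
    -- carries the whole tail `(1 - p) ^ m`, and the hypothesis on `b` absorbs this.
    have e1 : ∑ i ∈ Finset.range m, truncGeomWeight p (M + 1) (i + 1) *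
        (if i + 1 = m + 1 then 1 else if i + 1 < m + 1 then a else 0)
        = (1 - (1 - p) ^ m) * a := by
      rw [← sum_range_geom, Finset.sum_mul]
      refine Finset.sum_congr rfl fun i hi => ?_
      rw [Finset.mem_range] at hi
      rw [if_neg (by omega), if_pos (by omega), truncGeomWeight_succ_of_lt p (by omega)]
    rw [e1]
    have hp1 : 0 ≤ (1 - p) ^ m := pow_nonneg h2 m
    rcases hmM.lt_or_eq with hlt | rfl
    · rw [truncGeomWeight_succ_of_lt p (by omega)]
      nlinarith
    · rw [truncGeomWeight_succ_self]
      have := hd rfl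
      rw [Nat.add_sub_cancel] at this
      nlinarith [h0.trans ha]
  · rw [not_le] at hdK
    refine le_trans (le_of_eq ?_) hab
    have e1 : ∀ i ∈ Finset.range (M + 1), truncGeomWeight p (M + 1) (i + 1) *
        (if ((i + 1 : ℕ) : ℕ∞) = d then 1 else if ((i + 1 : ℕ) : ℕ∞) < d then a else 0)
        = truncGeomWeight p (M + 1) (i + 1) * a := by
      intro i hi
      rw [Finset.mem_range] at hi
      have : ((i + 1 : ℕ) : ℕ∞) < d := lt_of_le_of_lt (Nat.cast_le.2 (by omega)) hdK
      rw [if_neg this.ne, if_pos this]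
    rw [Finset.sum_congr rfl e1, ← Finset.sum_mul, Finset.sum_range_succ,
      truncGeomWeight_succ_self, Finset.sum_congr rfl fun i hi =>
        truncGeomWeight_succ_of_lt p (by rw [Finset.mem_range] at hi; omega), sum_range_geom]
    ring

theorem PMF.toOuterMeasure_bind_le_of_forall {α β : Type*} (p : PMF α) (f : α → PMF β) (s : Set β)
    (c : ℝ≥0∞) (h : ∀ a ∈ p.support, (f a).toOuterMeasure s ≤ c) :
    (p.bind f).toOuterMeasure s ≤ c := by
  rw [PMF.toOuterMeasure_bind_apply]
  calc ∑' a, p a * (f a).toOuterMeasure s ≤ ∑' a, p a * c := by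
        refine ENNReal.tsum_le_tsum fun a => ?_
        by_cases ha : a ∈ p.support
        · exact mul_le_mul_right (h a ha) _
        · rw [(p.apply_eq_zero_iff a).2 ha, zero_mul, zero_mul]
    _ = c := by rw [ENNReal.tsum_mul_right, p.tsum_coe, one_mul]

theorem PMF.toOuterMeasure_eq_zero_of_forall {α : Type*} (p : PMF α) (s : Set α)
    (h : ∀ a ∈ p.support, a ∉ s) : p.toOuterMeasure s = 0 := by
  rw [PMF.toOuterMeasure_apply_eq_zero_iff, Set.disjoint_left]
  exact h

open Classical in
/-- A vertex becomes blue with probability at most `p` plus `(1 - p) ^ (K - 1)` for each vertex at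
distance exactly `K`. -/
theorem dbDimLoop_blue_le {W : Type} (H : SimpleGraph W) (p : ℝ) (h0 : 0 ≤ p) (h1 : p ≤ 1)
    (K : ℕ) (hK : 1 ≤ K) (e : W) (t : ℕ) (white B : Finset W) (heB : e ∉ B) :
    (dbDimLoop H p K t white B).toOuterMeasure {B' | e ∈ B'} ≤
      ENNReal.ofReal (p + (1 - p) ^ (K - 1) *
        (white.filter fun x => H.edist x e = (K : ℕ∞)).card) := by
  have h2 : 0 ≤ 1 - p := by linarith
  induction t generalizing white B with
  | zero =>
    refine le_of_eq_of_le (PMF.toOuterMeasure_eq_zero_of_forall _ _ fun B' hB' => ?_) zero_le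
    simp only [dbDimLoop, PMF.support_pure, Set.mem_singleton_iff] at hB'
    subst hB'
    exact heB
  | succ t ih =>
    by_cases hew : e ∈ white
    swap
    · refine le_of_eq_of_le (PMF.toOuterMeasure_eq_zero_of_forall _ _ fun B' hB' he => ?_) zero_le
      exact ((dbDimLoop_support_subset H p K _ _ _ B' hB' e).2 he).elim heB hew
    unfold dbDimLoop
    rw [dif_pos ⟨e, hew⟩]
    refine PMF.toOuterMeasure_bind_le_of_forall _ _ _ _ fun u hu => ?_
    replace hu : u ∈ white := (PMF.mem_support_uniformOfFinset_iff ⟨e, hew⟩ u).1 hu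
    rw [PMF.toOuterMeasure_bind_apply]
    set N : ℕ := (white.filter fun x => H.edist x e = (K : ℕ∞)).card with hN
    -- A vertex serves as centre at most once. Choosing one at distance `K` lowers the count by one,
    -- and this drop pays for the truncation error of the iteration.
    set N' : ℕ := ((white.erase u).filter fun x => H.edist x e = (K : ℕ∞)).card with hN'
    have hN'N : N' ≤ N :=
      Finset.card_le_card (Finset.filter_subset_filter _ (Finset.erase_subset _ _))
    have hN'1 : H.edist u e = (K : ℕ∞) → N' + 1 ≤ N := by
      intro hd
      have : u ∈ white.filter fun x => H.edist x e = (K : ℕ∞) := by simp [hu, hd]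
      rw [hN', hN, Finset.filter_erase, Finset.card_erase_of_mem this]
      have := Finset.card_pos.2 ⟨u, this⟩
      omega
    have hc : 0 ≤ (1 - p) ^ (K - 1) := pow_nonneg h2 _
    set a : ℝ := p + (1 - p) ^ (K - 1) * N' with ha
    have ha0 : 0 ≤ a := by positivity
    refine le_trans (ENNReal.tsum_le_tsum (g := fun Q => truncGeom p K Q * ENNReal.ofReal
      (if (Q : ℕ∞) = H.edist u e then 1 else if (Q : ℕ∞) < H.edist u e then a else 0))
      fun Q => ?_) ?_
    · by_cases hQ : Q ∈ (truncGeom p K).support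
      swap
      · rw [((truncGeom p K).apply_eq_zero_iff Q).2 hQ, zero_mul, zero_mul]
      refine mul_le_mul_right ?_ _
      -- The radius hits `e` (bounded by `1`), falls short of it (`e` stays white, induction), or
      -- passes it (`e` turns red for good).
      split_ifs with c1 c2
      · rw [ENNReal.ofReal_one]
        exact (MeasureTheory.measure_mono (Set.subset_univ _)).trans_eq
          ((PMF.toOuterMeasure_apply_eq_one_iff _ _).2 (Set.subset_univ _))
      · refine (ih _ _ ?_).trans (ENNReal.ofReal_le_ofReal ?_)
        · simp only [Finset.mem_union, Finset.mem_filter, not_or, not_and]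
          exact ⟨heB, fun _ h => c1 h.symm⟩
        · have : ((white.filter fun w => (Q : ℕ∞) < H.edist u w).filter
              fun x => H.edist x e = (K : ℕ∞)).card ≤ N' := by
            refine Finset.card_le_card (Finset.filter_subset_filter _ fun x hx => ?_)
            rw [Finset.mem_filter] at hx
            rw [Finset.mem_erase]
            refine ⟨?_, hx.1⟩
            rintro rfl
            simp at hx
          rw [ha]
          gcongr
      · rw [ENNReal.ofReal_zero]
        refine le_of_eq (PMF.toOuterMeasure_eq_zero_of_forall _ _ fun B' hB' he => ?_)
        have := (dbDimLoop_support_subset H p K _ _ _ B' hB' e).2 he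
        simp only [Finset.mem_union, Finset.mem_filter] at this
        rcases this with (h | h) | h
        · exact heB h
        · exact c1 h.2.symm
        · exact c2 h.2
    · rw [tsum_truncGeom_mul p h0 h1 K hK]
      · refine ENNReal.ofReal_le_ofReal
          (sum_truncGeomWeight_mul_le p h0 h1 K hK (H.edist u e) a _ ?_ ?_ ?_)
        · rw [ha]; nlinarith [mul_nonneg hc (Nat.cast_nonneg (α := ℝ) N')]
        · rw [ha]; gcongr
        · intro hd
          have : (N' : ℝ) + 1 ≤ N := by exact_mod_cast hN'1 hd
          rw [ha]
          nlinarith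
      · intro i
        split_ifs <;> linarith

/-! ### Growth of balls in graphs of bounded doubling dimension. -/

section

variable {V : Type*} {G : SimpleGraph V} {ρ : ℕ}

theorem exists_cover_of_doublingDim_le (h : doublingDim G ≤ (ρ : ℕ∞)) (v : V) (r : ℝ≥0) :
    ∃ u : Fin (2 ^ ρ) → V, graphBall G v r ⊆ ⋃ i, graphBall G (u i) (r / 2) := by
  have h1 : localDoublingDim G v r ≤ ρ :=
    (le_iSup₂ (f := fun (v : V) (r : ℝ≥0) => localDoublingDim G v r) v r).trans h
  by_contra hcon
  have h2 : ((ρ + 1 : ℕ) : ℕ∞) ≤ localDoublingDim G v r := by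
    refine le_iInf₂ fun k hk => ?_
    rw [Nat.cast_le]
    by_contra hlt
    have hkρ : k ≤ ρ := by omega
    obtain ⟨u, hu⟩ := hk
    -- A cover by fewer balls is padded with balls around `v`.
    refine hcon ⟨fun i => if hi : (i : ℕ) < 2 ^ k then u ⟨i, hi⟩ else v, hu.trans ?_⟩
    refine Set.iUnion_subset fun i => ?_
    have hle : 2 ^ k ≤ 2 ^ ρ := Nat.pow_le_pow_right (by norm_num) hkρ
    refine Set.subset_iUnion_of_subset ⟨i, i.2.trans_le hle⟩ ?_
    simp
  have := h2.trans h1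
  rw [Nat.cast_le] at this
  omega

theorem mem_graphBall_natCast {v u : V} {m : ℕ} :
    u ∈ graphBall G v (m : ℝ) ↔ G.edist u v < m := by
  rw [graphBall, Set.mem_ofPred_eq, ENNReal.ofReal_natCast, ← ENat.toENNReal_coe,
    ENat.toENNReal_lt]

/-- Halving the radius `j` times costs a factor `2 ^ ρ` each time and ends with open balls of radius
`1`, which are single points. -/
theorem ncard_graphBall_two_pow_le [Finite V] (h : doublingDim G ≤ (ρ : ℕ∞)) (v : V) (j : ℕ) :
    (graphBall G v (2 ^ j)).ncard ≤ 2 ^ (ρ * j) := by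
  induction j generalizing v with
  | zero =>
    have : graphBall G v (2 ^ 0) ⊆ {v} := by
      intro u hu
      have hu' : u ∈ graphBall G v ((1 : ℕ) : ℝ) := by simpa using hu
      rw [mem_graphBall_natCast, Nat.cast_one, Order.lt_one_iff,
        SimpleGraph.edist_eq_zero_iff] at hu'
      exact hu'
    simpa using Set.ncard_le_ncard this
  | succ j ih =>
    obtain ⟨u, hu⟩ := exists_cover_of_doublingDim_le h v (2 ^ (j + 1))
    have e : (((2 : ℝ≥0) ^ (j + 1) : ℝ≥0) : ℝ) / 2 = 2 ^ j := by
      push_cast; rw [pow_succ]; ring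
    rw [e] at hu
    push_cast at hu
    calc (graphBall G v (2 ^ (j + 1))).ncard
        ≤ (⋃ i, graphBall G (u i) (2 ^ j)).ncard := Set.ncard_le_ncard hu (Set.toFinite _)
      _ ≤ ∑ i, (graphBall G (u i) (2 ^ j)).ncard := Set.ncard_iUnion_le_of_fintype _
      _ ≤ ∑ _i : Fin (2 ^ ρ), 2 ^ (ρ * j) := Finset.sum_le_sum fun i _ => ih (u i)
      _ = 2 ^ (ρ * (j + 1)) := by simp [mul_add, pow_add, mul_comm]

/-- Balls in graphs of bounded doubling dimension grow polynomially. -/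
theorem card_le_of_forall_edist_le [Finite V] (h : doublingDim G ≤ (ρ : ℕ∞)) (v : V) (j : ℕ)
    (s : Finset V) (hs : ∀ w ∈ s, G.edist v w ≤ j) : s.card ≤ (2 * (j + 1)) ^ ρ := by
  -- The closed ball of radius `j` lies in the open ball of radius `2 ^ m`; rounding `j + 1` up to a
  -- power of two loses at most the factor `2` in the statement.
  set m := Nat.clog 2 (j + 1) with hm
  have h1 : j + 1 ≤ 2 ^ m := Nat.le_pow_clog (by norm_num) _
  have h2 : 2 ^ m ≤ 2 * (j + 1) := by
    rcases Nat.eq_zero_or_pos j with rfl | hj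
    · simp [hm]
    · have h3 := Nat.pow_pred_clog_lt_self (b := 2) (by norm_num) (x := j + 1) (by omega)
      rw [← hm] at h3
      have h4 : 0 < m := Nat.clog_pos (by norm_num) (by omega)
      obtain ⟨m', hm'⟩ : ∃ m', m = m' + 1 := ⟨m - 1, by omega⟩
      rw [hm'] at h3 ⊢
      rw [Nat.pred_succ] at h3
      rw [pow_succ]
      omega
  have hsub : (s : Set V) ⊆ graphBall G v (2 ^ m) := by
    intro w hw
    have : w ∈ graphBall G v ((2 ^ m : ℕ) : ℝ) := by
      rw [mem_graphBall_natCast, G.edist_comm]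
      refine (hs w hw).trans_lt ?_
      rw [Nat.cast_lt]
      omega
    simpa using this
  calc s.card = (s : Set V).ncard := (Set.ncard_coe_finset s).symm
    _ ≤ _ := Set.ncard_le_ncard hsub (Set.toFinite _)
    _ ≤ 2 ^ (ρ * m) := ncard_graphBall_two_pow_le h v m
    _ = (2 ^ m) ^ ρ := by rw [← pow_mul, mul_comm]
    _ ≤ _ := Nat.pow_le_pow_left h2 ρ

/-- The open ball of radius `2` is the closed neighbourhood of `v`, and it is covered by `2 ^ ρ`
points. The extra `1` for `v` itself is what rules out edges when `ρ = 0`. -/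
theorem card_lt_of_forall_adj [Finite V] (h : doublingDim G ≤ (ρ : ℕ∞)) (v : V)
    (s : Finset V) (hs : ∀ w ∈ s, G.Adj v w) : s.card + 1 ≤ 2 ^ ρ := by
  classical
  have hv : v ∉ s := fun hv => G.irrefl (hs v hv)
  rw [← Finset.card_insert_of_notMem hv, ← Set.ncard_coe_finset]
  refine (Set.ncard_le_ncard ?_ (Set.toFinite _)).trans
    ((ncard_graphBall_two_pow_le h v 1).trans (by simp))
  intro w hw
  have : w ∈ graphBall G v ((2 : ℕ) : ℝ) := by
    rw [mem_graphBall_natCast]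
    rcases Finset.mem_insert.1 hw with rfl | hw
    · simp
    · rw [SimpleGraph.edist_eq_one_iff_adj.2 (hs w hw).symm]
      norm_num
  simpa using this

end

/-! ### The graph of the edges, and the size of the components. -/

section

variable {n : ℕ} {G : SimpleGraph (Fin n)} {ρ : ℕ}

theorem mem_edgePairs {e : Fin n × Fin n} : e ∈ edgePairs G ↔ e.1 < e.2 ∧ G.Adj e.1 e.2 := by
  simp [edgePairs]

theorem mkEdge_comm (u v : Fin n) : mkEdge u v = mkEdge v u := by
  simp [mkEdge, min_comm, max_comm]

theorem mkEdge_of_lt {u v : Fin n} (h : u < v) : mkEdge u v = (u, v) := by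
  simp [mkEdge, min_eq_left h.le, max_eq_right h.le]

theorem mkEdge_mem_edgePairs {u v : Fin n} (h : G.Adj u v) : mkEdge u v ∈ edgePairs G := by
  rcases lt_trichotomy u v with h1 | rfl | h1
  · rw [mkEdge_of_lt h1, mem_edgePairs]; exact ⟨h1, h⟩
  · exact absurd h G.irrefl
  · rw [mkEdge_comm, mkEdge_of_lt h1, mem_edgePairs]; exact ⟨h1, h.symm⟩

/-- The end points of an edge. -/
def IsEndpoint (w : Fin n) (e : Fin n × Fin n) : Prop := w = e.1 ∨ w = e.2

theorem isEndpoint_mkEdge {u v w : Fin n} : IsEndpoint w (mkEdge u v) ↔ w = u ∨ w = v := by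
  rcases le_total u v with h | h
  · simp [IsEndpoint, mkEdge, h]
  · simp [IsEndpoint, mkEdge, h, or_comm]

theorem edgeGraph_adj_iff {e f : Fin n × Fin n} : (edgeGraph G).Adj e f ↔
    e ≠ f ∧ e ∈ edgePairs G ∧ f ∈ edgePairs G ∧ ∃ w, IsEndpoint w e ∧ IsEndpoint w f := by
  change (e ≠ f ∧ e ∈ edgePairs G ∧ f ∈ edgePairs G ∧ _) ↔ _
  have : (e.1 = f.1 ∨ e.1 = f.2 ∨ e.2 = f.1 ∨ e.2 = f.2) ↔
      ∃ w, IsEndpoint w e ∧ IsEndpoint w f := by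
    unfold IsEndpoint
    constructor
    · rintro (h | h | h | h)
      exacts [⟨e.1, by simp, by simp [h]⟩, ⟨e.1, by simp, by simp [h]⟩,
        ⟨e.2, by simp, by simp [h]⟩, ⟨e.2, by simp, by simp [h]⟩]
    · rintro ⟨w, rfl | rfl, h | h⟩ <;> simp [h]
  rw [this]

theorem edist_le_one_of_isEndpoint {e : Fin n × Fin n} (he : e ∈ edgePairs G) {v w : Fin n}
    (hv : IsEndpoint v e) (hw : IsEndpoint w e) : G.edist v w ≤ 1 := by
  have hadj := (mem_edgePairs.1 he).2
  rcases hv with rfl | rfl <;> rcases hw with rfl | rfl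
  · simp
  · exact (SimpleGraph.edist_eq_one_iff_adj.2 hadj).le
  · exact (SimpleGraph.edist_eq_one_iff_adj.2 hadj.symm).le
  · simp

/-- Distances in the graph of the edges bound the distances of the end points. -/
theorem edist_endpoint_le {e f : Fin n × Fin n} (he : e ∈ edgePairs G) {j : ℕ}
    (h : (edgeGraph G).edist e f ≤ j) : f ∈ edgePairs G ∧
      ∀ v w, IsEndpoint v e → IsEndpoint w f → G.edist v w ≤ (j + 1 : ℕ) := by
  induction j generalizing f with
  | zero =>
    have : e = f := by simpa using h
    subst this
    exact ⟨he, fun v w hv hw => by simpa using edist_le_one_of_isEndpoint he hv hw⟩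
  | succ j ih =>
    rcases h.lt_or_eq with hlt | heq
    · have := ih (by push_cast at hlt; exact Order.le_of_lt_add_one hlt)
      exact ⟨this.1, fun v w hv hw => (this.2 v w hv hw).trans (by norm_cast; omega)⟩
    · obtain ⟨f', hadj, hf'⟩ := SimpleGraph.exists_adj_edist_eq_of_edist_eq_succ _ heq
      have := ih hf'.le
      obtain ⟨-, -, hf, x, hx1, hx2⟩ := edgeGraph_adj_iff.1 hadj
      refine ⟨hf, fun v w hv hw => (G.edist_triangle (v := x)).trans ?_⟩
      push_cast
      exact add_le_add (by simpa using this.2 v x hv hx1) (edist_le_one_of_isEndpoint hf hx2 hw)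

/-- Balls in the graph of the edges grow polynomially. -/
theorem card_edges_le_of_edist_le (h : doublingDim G ≤ (ρ : ℕ∞)) {e : Fin n × Fin n}
    (he : e ∈ edgePairs G) (j : ℕ) (s : Finset (Fin n × Fin n))
    (hs : ∀ f ∈ s, (edgeGraph G).edist e f ≤ j) : s.card ≤ (4 * (j + 2)) ^ ρ := by
  classical
  have h1 : (s.image Prod.fst).card ≤ (2 * (j + 1 + 1)) ^ ρ := by
    refine card_le_of_forall_edist_le h e.1 (j + 1) _ fun w hw => ?_
    obtain ⟨f, hf, rfl⟩ := Finset.mem_image.1 hw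
    exact (edist_endpoint_le he (hs f hf)).2 _ _ (Or.inl rfl) (Or.inl rfl)
  -- Edges are counted through their smaller end point, each of which carries fewer than `2 ^ ρ`
  -- edges.
  have h2 : s.card ≤ 2 ^ ρ * (s.image Prod.fst).card := by
    refine Finset.card_le_mul_card_image s _ fun u _ => ?_
    have : ((s.filter fun f => f.1 = u).image Prod.snd).card + 1 ≤ 2 ^ ρ := by
      refine card_lt_of_forall_adj h u _ fun w hw => ?_
      obtain ⟨f, hf, rfl⟩ := Finset.mem_image.1 hw
      obtain ⟨hfs, rfl⟩ := Finset.mem_filter.1 hf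
      exact (mem_edgePairs.1 (edist_endpoint_le he (hs f hfs)).1).2
    rw [Finset.card_image_of_injOn] at this
    · omega
    · intro f hf g hg hfg
      simp only [Finset.coe_filter, Set.mem_ofPred_eq] at hf hg
      exact Prod.ext (hf.2.trans hg.2.symm) hfg
  calc s.card ≤ 2 ^ ρ * (2 * (j + 1 + 1)) ^ ρ := h2.trans (Nat.mul_le_mul_left _ h1)
    _ = (4 * (j + 2)) ^ ρ := by rw [← mul_pow]; congr 1; ring

/-- The components of `(V, E \ B)` are small. -/
theorem card_component_le (h : doublingDim G ≤ (ρ : ℕ∞)) (p : ℝ) (k : ℕ)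
    {B : Finset (Fin n × Fin n)}
    (hB : B ∈ (dbDim (edgeGraph G) p k (edgePairs G)).support) (v : Fin n) (s : Finset (Fin n))
    (hs : ∀ w ∈ s, (removeEdges G B).Reachable v w) : s.card ≤ (2 * (k + 2)) ^ ρ := by
  obtain ⟨c, hc1, hc2⟩ := dbDimLoop_support_centre (edgeGraph G) p k _ _ _ le_rfl B hB
  by_cases hv : ∃ v', (removeEdges G B).Adj v v'
  · obtain ⟨v', hv'⟩ := hv
    set e₀ := mkEdge v v' with he₀
    have he₀m : e₀ ∈ edgePairs G := mkEdge_mem_edgePairs hv'.1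
    -- Consecutive edges of a walk in `(V, E \ B)` share an end point and are both red, so the
    -- centre of the first edge is carried along the whole walk.
    have key : ∀ w, (removeEdges G B).Reachable v w →
        ∃ f ∈ edgePairs G, f ∉ B ∧ IsEndpoint w f ∧ c f = c e₀ := by
      intro w hw
      rw [SimpleGraph.reachable_iff_reflTransGen] at hw
      induction hw with
      | refl => exact ⟨e₀, he₀m, hv'.2, isEndpoint_mkEdge.2 (Or.inl rfl), rfl⟩
      | @tail w x _ hwx ih =>
        obtain ⟨f, hf, hfB, hwf, hcf⟩ := ih
        have hg : mkEdge w x ∈ edgePairs G := mkEdge_mem_edgePairs hwx.1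
        refine ⟨mkEdge w x, hg, hwx.2, isEndpoint_mkEdge.2 (Or.inr rfl), ?_⟩
        by_cases hfg : mkEdge w x = f
        · rw [hfg, hcf]
        · rw [← hcf]
          exact hc2 _ hg _ hf hwx.2 hfB (edgeGraph_adj_iff.2
            ⟨hfg, hg, hf, w, isEndpoint_mkEdge.2 (Or.inl rfl), hwf⟩)
    refine card_le_of_forall_edist_le h (c e₀).1 (k + 1) s fun w hw => ?_
    obtain ⟨f, hf, hfB, hwf, hcf⟩ := key w (hs w hw)
    obtain ⟨h1, h2⟩ := hc1 f hf hfB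
    rw [← hcf]
    exact (edist_endpoint_le h1 h2).2 _ _ (Or.inl rfl) hwf
  -- All edges at `v` are removed, so no centre is available and the component is a single node.
  · have : s ⊆ {v} := by
      intro w hw
      rw [Finset.mem_singleton]
      by_contra hne
      obtain ⟨p⟩ := hs w hw
      cases p with
      | nil => exact hne rfl
      | cons hadj _ => exact hv ⟨_, hadj⟩
    calc s.card ≤ 1 := by simpa using Finset.card_le_card this
      _ ≤ _ := Nat.one_le_pow _ _ (by omega)

end

/-! ### Factorization over components, the two bounds, and the greedy assignment. -/

namespace PairwiseMRF

variable {n q : ℕ} (M : PairwiseMRF n q) (B : Finset (Fin n × Fin n))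

open Classical in
/-- The exponent of the partition function restricted to `S`, for an assignment of all nodes. -/
noncomputable def restrictedEnergy (S : Finset (Fin n)) (x : Fin n → Fin q) : ℝ :=
  ∑ v ∈ S, M.nodePot v (x v) +
    ∑ u ∈ S, ∑ v, if u < v ∧ (removeEdges M.graph B).Adj u v then M.edgePot u v (x u) (x v) else 0

theorem mem_components {S : Finset (Fin n)} : S ∈ M.components B ↔
    ∃ v, ∀ w, w ∈ S ↔ (removeEdges M.graph B).Reachable v w := by
  simp only [components, Finset.mem_image, Finset.mem_univ, true_and]
  refine exists_congr fun v => ?_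
  rw [Finset.ext_iff]
  simp only [Finset.mem_filter, Finset.mem_univ, true_and]
  exact forall_congr' fun w => Iff.comm

variable {M B} in
theorem mem_of_mem_components {S : Finset (Fin n)} (hS : S ∈ M.components B) {u w : Fin n}
    (hu : u ∈ S) : w ∈ S ↔ (removeEdges M.graph B).Reachable u w := by
  obtain ⟨v, hv⟩ := (M.mem_components B).1 hS
  rw [hv] at hu ⊢
  exact ⟨fun h => hu.symm.trans h, fun h => hu.trans h⟩

theorem exists_mem_components (v : Fin n) : ∃ S ∈ M.components B, v ∈ S := by
  classical
  refine ⟨Finset.univ.filter fun w => (removeEdges M.graph B).Reachable v w,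
    (M.mem_components B).2 ⟨v, by simp⟩, ?_⟩
  simp only [Finset.mem_filter, Finset.mem_univ, true_and]
  exact SimpleGraph.Reachable.refl v

variable {M B} in
theorem components_eq {S T : Finset (Fin n)} (hS : S ∈ M.components B) (hT : T ∈ M.components B)
    {v : Fin n} (h1 : v ∈ S) (h2 : v ∈ T) : S = T := by
  ext w
  rw [mem_of_mem_components hS h1, mem_of_mem_components hT h2]

/-- A component contains all its neighbours in `(V, E \ B)`, so the energy on it depends only on the
values inside, and any extension `f` of the local assignments may be used. -/
theorem restrictedPartitionFn_eq {S : Finset (Fin n)} (hS : S ∈ M.components B)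
    (f : (S → Fin q) → Fin n → Fin q) (hf : ∀ x (v : S), f x v = x v) :
    M.restrictedPartitionFn B S = ∑ x : S → Fin q, Real.exp (M.restrictedEnergy B S (f x)) := by
  classical
  unfold restrictedPartitionFn restrictedEnergy
  refine Finset.sum_congr rfl fun x _ => ?_
  congr 2
  · rw [← Finset.sum_coe_sort S]
    exact Finset.sum_congr rfl fun v _ => by rw [hf]
  · rw [← Finset.sum_coe_sort S]
    refine Finset.sum_congr rfl fun u _ => ?_
    rw [← Finset.sum_subset (Finset.subset_univ S), ← Finset.sum_coe_sort S]
    · refine Finset.sum_congr rfl fun v _ => ?_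
      rw [hf, hf]
      simp only [Subtype.coe_lt_coe]
    · intro v _ hv
      rw [if_neg]
      rintro ⟨-, hadj⟩
      exact hv ((mem_of_mem_components hS u.2).2 hadj.reachable)

theorem sum_components {g : Fin n → ℝ} :
    ∑ S ∈ M.components B, ∑ v ∈ S, g v = ∑ v, g v := by
  classical
  have hdis : (M.components B : Set (Finset (Fin n))).PairwiseDisjoint id := fun S hS T hT hne =>
    Finset.disjoint_left.2 fun v h1 h2 => hne (components_eq hS hT h1 h2)
  refine (Finset.sum_biUnion (f := g) hdis).symm.trans ?_
  congr 1
  ext v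
  simpa using M.exists_mem_components B v

theorem sum_edges_removed (g : Fin n → Fin n → ℝ)
    [∀ u v, Decidable (u < v ∧ (removeEdges M.graph B).Adj u v)] :
    ∑ u, ∑ v, (if u < v ∧ (removeEdges M.graph B).Adj u v then g u v else 0)
      = ∑ e ∈ edgePairs M.graph \ B, g e.1 e.2 := by
  classical
  rw [← Finset.sum_product', ← Finset.sum_filter]
  refine Finset.sum_congr ?_ fun _ _ => rfl
  ext ⟨u, v⟩
  simp only [Finset.univ_product_univ, Finset.mem_filter, Finset.mem_univ, true_and,
    Finset.mem_sdiff, mem_edgePairs]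
  constructor
  · rintro ⟨h1, h2, h3⟩
    rw [mkEdge_of_lt h1] at h3
    exact ⟨⟨h1, h2⟩, h3⟩
  · rintro ⟨⟨h1, h2⟩, h3⟩
    refine ⟨h1, h2, ?_⟩
    rwa [mkEdge_of_lt h1]

/-- The partition function of `(V, E \ B)` is the product over the components. -/
theorem prod_restrictedPartitionFn :
    ∏ S ∈ M.components B, M.restrictedPartitionFn B S = ∑ x : Fin n → Fin q,
      Real.exp (∑ v, M.nodePot v (x v) +
        ∑ e ∈ edgePairs M.graph \ B, M.edgePot e.1 e.2 (x e.1) (x e.2)) := by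
  classical
  -- The empty alphabet is treated apart, since the extension by a default letter below needs one.
  by_cases hq : q = 0
  · subst hq
    rcases Nat.eq_zero_or_pos n with rfl | hn
    · have : M.components B = ∅ := by
        rw [Finset.eq_empty_iff_forall_notMem]
        intro S hS
        obtain ⟨v, -⟩ := (M.mem_components B).1 hS
        exact v.elim0
      rw [this, Finset.prod_empty, Fintype.sum_unique]
      have h2 : (edgePairs M.graph \ B) = ∅ := by
        rw [Finset.eq_empty_iff_forall_notMem]
        intro e _
        exact e.1.elim0
      simp [h2]
    · have : IsEmpty (Fin n → Fin 0) := ⟨fun x => (x ⟨0, hn⟩).elim0⟩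
      rw [Finset.univ_eq_empty, Finset.sum_empty]
      obtain ⟨S, hS, hv⟩ := M.exists_mem_components B ⟨0, hn⟩
      refine Finset.prod_eq_zero hS ?_
      have : IsEmpty (S → Fin 0) := ⟨fun x => (x ⟨⟨0, hn⟩, hv⟩).elim0⟩
      rw [restrictedPartitionFn, Finset.univ_eq_empty, Finset.sum_empty]
  have : NeZero q := ⟨hq⟩
  have e1 : ∀ S ∈ M.components B, M.restrictedPartitionFn B S = ∑ x : S → Fin q,
      Real.exp (M.restrictedEnergy B S (fun v => if h : v ∈ S then x ⟨v, h⟩ else 0)) :=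
    fun S hS => M.restrictedPartitionFn_eq B hS _ fun x v => by simp
  rw [Finset.prod_congr rfl e1, ← Finset.prod_coe_sort, Finset.prod_univ_sum]
  symm
  simp only [Fintype.piFinset_univ]
  -- The components partition the nodes, so families of local assignments are the same as global
  -- ones.
  refine Fintype.sum_bijective
    (fun (x : Fin n → Fin q) (S : M.components B) (v : S.1) => x v) ⟨?_, ?_⟩ _ _ ?_
  · intro x y hxy
    funext v
    obtain ⟨S, hS, hv⟩ := M.exists_mem_components B v
    exact congrFun (congrFun hxy ⟨S, hS⟩) ⟨v, hv⟩
  · intro y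
    choose c hc hc' using M.exists_mem_components B
    refine ⟨fun v => y ⟨c v, hc v⟩ ⟨v, hc' v⟩, ?_⟩
    funext ⟨S, hS⟩ ⟨v, hv⟩
    have : c v = S := components_eq (hc v) hS (hc' v) hv
    subst this
    rfl
  · intro x
    rw [← Real.exp_sum]
    congr 1
    have e2 : ∀ S ∈ M.components B,
        M.restrictedEnergy B S (fun v => if h : v ∈ S then x v else 0)
          = M.restrictedEnergy B S x := by
      intro S hS
      unfold restrictedEnergy
      congr 1
      · exact Finset.sum_congr rfl fun v hv => by simp [hv]
      · refine Finset.sum_congr rfl fun u hu => Finset.sum_congr rfl fun v _ => ?_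
        by_cases h : u < v ∧ (removeEdges M.graph B).Adj u v
        · have hv := (mem_of_mem_components hS hu).2 h.2.reachable
          simp [h, hu, hv]
        · simp [h]
    calc _ = ∑ S ∈ M.components B, M.restrictedEnergy B S x := by
          unfold restrictedEnergy
          rw [Finset.sum_add_distrib, sum_components, sum_components, sum_edges_removed M B
            fun u v => M.edgePot u v (x u) (x v)]
      _ = ∑ S : M.components B,
          M.restrictedEnergy B S.1 (fun v => if h : v ∈ S.1 then x v else 0) := by
          rw [← Finset.sum_coe_sort]
          exact Finset.sum_congr rfl fun S _ => (e2 S.1 S.2).symm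

theorem edgePot_nonneg_of_mem {e : Fin n × Fin n} (he : e ∈ edgePairs M.graph) (a b : Fin q) :
    0 ≤ M.edgePot e.1 e.2 a b :=
  M.edgePot_nonneg _ _ _ _ (mem_edgePairs.1 he).1 (mem_edgePairs.1 he).2

variable [NeZero q]

theorem restrictedPartitionFn_pos (S : Finset (Fin n)) : 0 < M.restrictedPartitionFn B S :=
  Finset.sum_pos (fun _ _ => Real.exp_pos _) Finset.univ_nonempty

theorem partitionFn_pos : 0 < M.partitionFn :=
  Finset.sum_pos (fun _ _ => Real.exp_pos _) Finset.univ_nonempty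

theorem edgeMin_le (e : Fin n × Fin n) (a b : Fin q) : M.edgeMin e ≤ M.edgePot e.1 e.2 a b :=
  Finset.inf'_le (fun ab : Fin q × Fin q => M.edgePot e.1 e.2 ab.1 ab.2) (Finset.mem_univ (a, b))

theorem le_edgeMax (e : Fin n × Fin n) (a b : Fin q) : M.edgePot e.1 e.2 a b ≤ M.edgeMax e :=
  Finset.le_sup' (fun ab : Fin q × Fin q => M.edgePot e.1 e.2 ab.1 ab.2) (Finset.mem_univ (a, b))

theorem exists_edgeMax (e : Fin n × Fin n) : ∃ a b, M.edgePot e.1 e.2 a b = M.edgeMax e := by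
  obtain ⟨ab, -, h⟩ := Finset.exists_mem_eq_sup' (s := Finset.univ) Finset.univ_nonempty
    (fun ab : Fin q × Fin q => M.edgePot e.1 e.2 ab.1 ab.2)
  exact ⟨ab.1, ab.2, h.symm⟩

theorem edgeMin_nonneg {e : Fin n × Fin n} (he : e ∈ edgePairs M.graph) : 0 ≤ M.edgeMin e :=
  (Finset.le_inf'_iff _ _).2 fun _ _ => M.edgePot_nonneg_of_mem he _ _

theorem edgeMax_nonneg {e : Fin n × Fin n} (he : e ∈ edgePairs M.graph) : 0 ≤ M.edgeMax e :=
  (M.edgePot_nonneg_of_mem he 0 0).trans (M.le_edgeMax e 0 0)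

theorem sum_log_components : ∑ S ∈ M.components B, Real.log (M.restrictedPartitionFn B S)
    = Real.log (∑ x : Fin n → Fin q, Real.exp (∑ v, M.nodePot v (x v) +
        ∑ e ∈ edgePairs M.graph \ B, M.edgePot e.1 e.2 (x e.1) (x e.2))) := by
  rw [← prod_restrictedPartitionFn, Real.log_prod]
  exact fun S _ => (M.restrictedPartitionFn_pos B S).ne'

variable {B} in
-- The minima over the removed edges enter as a constant factor of the partition function of `(V, E
-- \ B)`; the comparison is then made for each assignment separately.
theorem logLowerBound_le (hB : B ⊆ edgePairs M.graph) :
    M.logLowerBound B ≤ Real.log M.partitionFn := by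
  have hpos : 0 < ∑ x : Fin n → Fin q, Real.exp (∑ v, M.nodePot v (x v) +
      ∑ e ∈ edgePairs M.graph \ B, M.edgePot e.1 e.2 (x e.1) (x e.2)) :=
    Finset.sum_pos (fun _ _ => Real.exp_pos _) Finset.univ_nonempty
  rw [logLowerBound, sum_log_components]
  rw [← Real.log_exp (∑ e ∈ B, M.edgeMin e), ← Real.log_mul hpos.ne' (Real.exp_ne_zero _)]
  refine Real.log_le_log (mul_pos hpos (Real.exp_pos _)) ?_
  rw [Finset.sum_mul, partitionFn]
  refine Finset.sum_le_sum fun x _ => ?_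
  rw [← Real.exp_add, Real.exp_le_exp, ← Finset.sum_sdiff hB, add_assoc]
  gcongr
  exact M.edgeMin_le _ _ _

variable {B} in
theorem le_logUpperBound (hB : B ⊆ edgePairs M.graph) :
    Real.log M.partitionFn ≤ M.logUpperBound B := by
  have hpos : 0 < ∑ x : Fin n → Fin q, Real.exp (∑ v, M.nodePot v (x v) +
      ∑ e ∈ edgePairs M.graph \ B, M.edgePot e.1 e.2 (x e.1) (x e.2)) :=
    Finset.sum_pos (fun _ _ => Real.exp_pos _) Finset.univ_nonempty
  rw [logUpperBound, sum_log_components]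
  rw [← Real.log_exp (∑ e ∈ B, M.edgeMax e), ← Real.log_mul hpos.ne' (Real.exp_ne_zero _)]
  refine Real.log_le_log M.partitionFn_pos ?_
  rw [Finset.sum_mul, partitionFn]
  refine Finset.sum_le_sum fun x _ => ?_
  rw [← Real.exp_add, Real.exp_le_exp, ← Finset.sum_sdiff hB, add_assoc]
  gcongr
  exact M.le_edgeMax _ _ _

/-- Greedy choice of an assignment: it collects a fixed part of the sum of the maxima. -/
theorem exists_assignment_sum_edgeMax_le {D : ℕ}
    (hD : ∀ (v : Fin n) (s : Finset (Fin n)), (∀ w ∈ s, M.graph.Adj v w) → s.card ≤ D)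
    (F : Finset (Fin n × Fin n)) (hF : F ⊆ edgePairs M.graph) : ∃ x : Fin n → Fin q,
      ∑ e ∈ F, M.edgeMax e ≤ 2 * D * ∑ e ∈ F, M.edgePot e.1 e.2 (x e.1) (x e.2) := by
  classical
  induction F using Finset.strongInduction with
  | H F ih =>
    rcases F.eq_empty_or_nonempty with rfl | hne
    · exact ⟨fun _ => 0, by simp⟩
    obtain ⟨e, he, hmax⟩ := F.exists_max_image M.edgeMax hne
    -- The heaviest edge `e` pays for all edges that meet it, itself included: there are at most `2
    -- D` of them, none heavier than `e`.
    set T := F.filter fun f => ∃ w, IsEndpoint w e ∧ IsEndpoint w f with hT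
    have heT : e ∈ T := Finset.mem_filter.2 ⟨he, e.1, Or.inl rfl, Or.inl rfl⟩
    have hTF : T ⊆ F := Finset.filter_subset _ _
    have hcard : T.card ≤ 2 * D := by
      have hsub : T ⊆ (Finset.univ.filter (M.graph.Adj e.1)).image (mkEdge e.1) ∪
          (Finset.univ.filter (M.graph.Adj e.2)).image (mkEdge e.2) := by
        intro f hf
        obtain ⟨hfF, w, hwe, hwf⟩ := Finset.mem_filter.1 hf
        obtain ⟨hlt, hadj⟩ := mem_edgePairs.1 (hF hfF)
        have key : ∃ w', M.graph.Adj w w' ∧ mkEdge w w' = f := by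
          rcases hwf with rfl | rfl
          · exact ⟨f.2, hadj, mkEdge_of_lt hlt⟩
          · exact ⟨f.1, hadj.symm, by rw [mkEdge_comm, mkEdge_of_lt hlt]⟩
        obtain ⟨w', h1, h2⟩ := key
        simp only [Finset.mem_union, Finset.mem_image, Finset.mem_filter, Finset.mem_univ,
          true_and]
        rcases hwe with rfl | rfl
        · exact Or.inl ⟨w', h1, h2⟩
        · exact Or.inr ⟨w', h1, h2⟩
      refine (Finset.card_le_card hsub).trans ((Finset.card_union_le _ _).trans ?_)
      have h1 := Finset.card_image_le (s := Finset.univ.filter (M.graph.Adj e.1)) (f := mkEdge e.1)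
      have h2 := Finset.card_image_le (s := Finset.univ.filter (M.graph.Adj e.2)) (f := mkEdge e.2)
      have h3 := hD e.1 (Finset.univ.filter (M.graph.Adj e.1)) (by simp)
      have h4 := hD e.2 (Finset.univ.filter (M.graph.Adj e.2)) (by simp)
      omega
    obtain ⟨x, hx⟩ := ih (F \ T) (Finset.sdiff_ssubset hTF ⟨e, heT⟩)
      (Finset.sdiff_subset.trans hF)
    obtain ⟨a, b, hab⟩ := M.exists_edgeMax e
    have hne12 : e.1 ≠ e.2 := (mem_edgePairs.1 (hF he)).1.ne
    -- The edges outside `T` avoid both end points of `e`, so making `e` attain its maximum there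
    -- leaves their potentials alone.
    refine ⟨Function.update (Function.update x e.1 a) e.2 b, ?_⟩
    set y := Function.update (Function.update x e.1 a) e.2 b with hy
    have hye : M.edgePot e.1 e.2 (y e.1) (y e.2) = M.edgeMax e := by
      rw [← hab, hy, Function.update_self, Function.update_of_ne hne12, Function.update_self]
    have hyf : ∀ f ∈ F \ T, M.edgePot f.1 f.2 (y f.1) (y f.2)
        = M.edgePot f.1 f.2 (x f.1) (x f.2) := by
      intro f hf
      obtain ⟨hfF, hfT⟩ := Finset.mem_sdiff.1 hf
      have hno : ∀ w, IsEndpoint w f → ¬ IsEndpoint w e := fun w h1 h2 =>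
        hfT (Finset.mem_filter.2 ⟨hfF, w, h2, h1⟩)
      have hw : ∀ w, IsEndpoint w f → y w = x w := by
        intro w h1
        have h2 := hno w h1
        rw [IsEndpoint, not_or] at h2
        rw [hy, Function.update_of_ne h2.2, Function.update_of_ne h2.1]
      rw [hw _ (Or.inl rfl), hw _ (Or.inr rfl)]
    have h1 : ∑ f ∈ T, M.edgeMax f ≤ 2 * D * M.edgeMax e := by
      calc ∑ f ∈ T, M.edgeMax f ≤ T.card • M.edgeMax e :=
            Finset.sum_le_card_nsmul _ _ _ fun f hf => hmax f (hTF hf)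
        _ = (T.card : ℝ) * M.edgeMax e := by rw [nsmul_eq_mul]
        _ ≤ 2 * D * M.edgeMax e := by
            refine mul_le_mul_of_nonneg_right ?_ (M.edgeMax_nonneg (hF he))
            exact_mod_cast hcard
    have h2 : M.edgeMax e ≤ ∑ f ∈ T, M.edgePot f.1 f.2 (y f.1) (y f.2) := by
      rw [← hye]
      exact Finset.single_le_sum (f := fun f : Fin n × Fin n => M.edgePot f.1 f.2 (y f.1) (y f.2))
        (fun f hf => M.edgePot_nonneg_of_mem (hF (hTF hf)) _ _) heT
    rw [← Finset.sum_sdiff hTF, ← Finset.sum_sdiff (f := fun f : Fin n × Fin n =>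
      M.edgePot f.1 f.2 (y f.1) (y f.2)) hTF, Finset.sum_congr rfl hyf, mul_add]
    have h3 := mul_le_mul_of_nonneg_left h2 (by positivity : (0 : ℝ) ≤ 2 * D)
    linarith

/-- The greedy assignment contributes a single term to `Z`, and nonnegative node potentials only
increase it. -/
theorem sum_edgeMax_le_log_partitionFn {D : ℕ}
    (hD : ∀ (v : Fin n) (s : Finset (Fin n)), (∀ w ∈ s, M.graph.Adj v w) → s.card ≤ D) :
    ∑ e ∈ edgePairs M.graph, M.edgeMax e ≤ 2 * D * Real.log M.partitionFn := by
  obtain ⟨x, hx⟩ := M.exists_assignment_sum_edgeMax_le hD _ subset_rfl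
  refine hx.trans (mul_le_mul_of_nonneg_left ?_ (by positivity))
  rw [Real.le_log_iff_exp_le M.partitionFn_pos]
  calc _ ≤ Real.exp (∑ v, M.nodePot v (x v) +
      ∑ e ∈ edgePairs M.graph, M.edgePot e.1 e.2 (x e.1) (x e.2)) := by
        rw [Real.exp_le_exp]
        have := Finset.sum_nonneg fun v (_ : v ∈ Finset.univ) => M.nodePot_nonneg v (x v)
        linarith
    _ ≤ _ := Finset.single_le_sum (f := fun x : Fin n → Fin q =>
        Real.exp (∑ v, M.nodePot v (x v) +
          ∑ e ∈ edgePairs M.graph, M.edgePot e.1 e.2 (x e.1) (x e.2)))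
        (fun _ _ => (Real.exp_pos _).le) (Finset.mem_univ x)

theorem log_partitionFn_nonneg : 0 ≤ Real.log M.partitionFn := by
  refine Real.log_nonneg ?_
  calc (1 : ℝ) ≤ Real.exp (∑ v, M.nodePot v 0 +
      ∑ e ∈ edgePairs M.graph, M.edgePot e.1 e.2 0 0) := by
        rw [Real.one_le_exp_iff]
        exact add_nonneg (Finset.sum_nonneg fun v _ => M.nodePot_nonneg v _)
          (Finset.sum_nonneg fun e he => M.edgePot_nonneg_of_mem he _ _)
    _ ≤ _ := Finset.single_le_sum (f := fun x : Fin n → Fin q =>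
        Real.exp (∑ v, M.nodePot v (x v) +
          ∑ e ∈ edgePairs M.graph, M.edgePot e.1 e.2 (x e.1) (x e.2)))
        (fun _ _ => (Real.exp_pos _).le) (Finset.mem_univ (fun _ => 0))

end PairwiseMRF

/-! ### The expected gap of the bounds. -/

/-- The output law lives on the uncountable set `ℝ × ℝ`; pulling it back to the finitely many edge
sets gives summability and the value of the expectation at once. -/
theorem PMF.hasSum_map_mul {α β : Type*} [Fintype α] (p : PMF α) (f : α → β) (g : β → ℝ) :
    HasSum (fun b => ((p.map f) b).toReal * g b) (∑ a, (p a).toReal * g (f a)) := by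
  classical
  have h1 : (fun b => ((p.map f) b).toReal * g b)
      = fun b => ∑ a, if b = f a then (p a).toReal * g (f a) else 0 := by
    funext b
    rw [PMF.map_apply, tsum_fintype, ENNReal.toReal_sum, Finset.sum_mul]
    · refine Finset.sum_congr rfl fun a _ => ?_
      split_ifs with h
      · rw [h]
      · simp
    · intro a _
      split_ifs
      · exact p.apply_ne_top a
      · exact ENNReal.zero_ne_top
  rw [h1]
  exact hasSum_sum fun a _ => hasSum_ite_eq (f a) _

namespace PairwiseMRF

variable {n q : ℕ} [NeZero q] (M : PairwiseMRF n q)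

/-- The expected gap of the bounds, if no edge is removed with probability larger than `c`. -/
theorem expected_gap_le (P : PMF (Finset (Fin n × Fin n)))
    (hP : ∀ B ∈ P.support, B ⊆ edgePairs M.graph) {c : ℝ} (hc : 0 ≤ c)
    (hPc : ∀ e ∈ edgePairs M.graph, P.toOuterMeasure {B | e ∈ B} ≤ ENNReal.ofReal c)
    {D : ℕ} (hD : ∀ (v : Fin n) (s : Finset (Fin n)), (∀ w ∈ s, M.graph.Adj v w) → s.card ≤ D) :
    ∑ B, (P B).toReal * (M.logUpperBound B - M.logLowerBound B)
      ≤ c * (2 * D * Real.log M.partitionFn) := by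
  classical
  have h1 : ∀ B, (P B).toReal * (M.logUpperBound B - M.logLowerBound B)
      ≤ ∑ e ∈ edgePairs M.graph, M.edgeMax e * (if e ∈ B then (P B).toReal else 0) := by
    intro B
    by_cases hB : B ∈ P.support
    · have hBE := hP B hB
      -- The component terms cancel, and the minima are dropped because they are nonnegative.
      have h2 : M.logUpperBound B - M.logLowerBound B ≤ ∑ e ∈ B, M.edgeMax e := by
        have := Finset.sum_nonneg fun e (he : e ∈ B) => M.edgeMin_nonneg (hBE he)
        unfold logUpperBound logLowerBound
        linarith
      calc _ ≤ (P B).toReal * ∑ e ∈ B, M.edgeMax e :=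
            mul_le_mul_of_nonneg_left h2 ENNReal.toReal_nonneg
        _ = _ := by
            rw [Finset.mul_sum, ← Finset.sum_subset hBE]
            · exact Finset.sum_congr rfl fun e he => by rw [if_pos he, mul_comm]
            · exact fun e _ he => by rw [if_neg he, mul_zero]
    · rw [(P.apply_eq_zero_iff B).2 hB]
      simp
  calc _ ≤ ∑ B, ∑ e ∈ edgePairs M.graph, M.edgeMax e * (if e ∈ B then (P B).toReal else 0) :=
        Finset.sum_le_sum fun B _ => h1 B
    _ = ∑ e ∈ edgePairs M.graph, M.edgeMax e * ∑ B, (if e ∈ B then (P B).toReal else 0) := by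
        rw [Finset.sum_comm]
        simp_rw [Finset.mul_sum]
    _ ≤ ∑ e ∈ edgePairs M.graph, M.edgeMax e * c := by
        refine Finset.sum_le_sum fun e he =>
          mul_le_mul_of_nonneg_left ?_ (M.edgeMax_nonneg he)
        have h3 := hPc e he
        rw [PMF.toOuterMeasure_apply_fintype] at h3
        have h4 := ENNReal.toReal_mono ENNReal.ofReal_ne_top h3
        rw [ENNReal.toReal_ofReal hc, ENNReal.toReal_sum] at h4
        · refine le_of_eq_of_le (Finset.sum_congr rfl fun B _ => ?_) h4
          by_cases h : e ∈ B <;> simp [Set.indicator, h]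
        · intro B _
          by_cases h : e ∈ B <;> simp [Set.indicator, h, P.apply_ne_top]
    _ ≤ _ := by
        rw [← Finset.sum_mul, mul_comm]
        exact mul_le_mul_of_nonneg_left (M.sum_edgeMax_le_log_partitionFn hD) hc

end PairwiseMRF

/-! ### Correctness of the deterministic routines. -/

namespace PairwiseMRF

section

variable {n : ℕ}

theorem listComponentEdges_time (adj : Fin n → List (Fin n)) (C : List (Fin n)) (D : ℕ)
    (hD : ∀ u ∈ C, (adj u).length ≤ D) :
    (listComponentEdges adj C).time ≤ C.length * (1 + D) := by
  refine Timed.foldl_time_le _ _ _ _ fun b a ha => ?_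
  rw [Timed.foldl_pure_time]
  exact hD a ha

/-- The loops prepend, which scrambles the order; membership, absence of repetitions and length need
the list only up to permutation. -/
theorem listComponentEdges_perm (adj : Fin n → List (Fin n)) (C : List (Fin n)) :
    (listComponentEdges adj C).val.Perm
      (C.flatMap fun u => ((adj u).filter (u < ·)).map (Prod.mk u)) := by
  have inner : ∀ (u : Fin n) (l : List (Fin n)) (F : List (Fin n × Fin n)),
      (Timed.foldl (fun F v => (pure (if u < v then (u, v) :: F else F) : Timed _)) F l).val.Perm
        (F ++ (l.filter (u < ·)).map (Prod.mk u)) := by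
    intro u l
    induction l with
    | nil => intro F; simp [Timed.foldl_nil]
    | cons a l ih =>
      intro F
      rw [Timed.foldl_cons_val]
      refine (ih _).trans ?_
      by_cases h : u < a
      · simpa [h] using List.perm_middle.symm
      · simp [h]
  have outer : ∀ F : List (Fin n × Fin n), (Timed.foldl (fun F u =>
      Timed.foldl (fun F v => (pure (if u < v then (u, v) :: F else F) : Timed _)) F (adj u))
      F C).val.Perm (F ++ C.flatMap fun u => ((adj u).filter (u < ·)).map (Prod.mk u)) := by
    induction C with
    | nil => intro F; simp [Timed.foldl_nil]
    | cons a C ih =>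
      intro F
      rw [Timed.foldl_cons_val]
      refine (ih _).trans ?_
      rw [List.flatMap_cons, ← List.append_assoc]
      exact (inner a (adj a) F).append_right _
  have := outer []
  rw [List.nil_append] at this
  exact this

theorem mem_listComponentEdges (adj : Fin n → List (Fin n)) (C : List (Fin n))
    (e : Fin n × Fin n) : e ∈ (listComponentEdges adj C).val ↔
      e.1 ∈ C ∧ e.2 ∈ adj e.1 ∧ e.1 < e.2 := by
  rw [(listComponentEdges_perm adj C).mem_iff]
  obtain ⟨a, b⟩ := e
  simp only [List.mem_flatMap, List.mem_map, List.mem_filter, decide_eq_true_eq, Prod.mk.injEq]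
  constructor
  · rintro ⟨u, hu, v, ⟨h1, h2⟩, rfl, rfl⟩
    exact ⟨hu, h1, h2⟩
  · rintro ⟨h1, h2, h3⟩
    exact ⟨a, h1, b, ⟨h2, h3⟩, rfl, rfl⟩

theorem nodup_listComponentEdges (adj : Fin n → List (Fin n)) (C : List (Fin n))
    (hC : C.Nodup) (hadj : ∀ u ∈ C, (adj u).Nodup) : (listComponentEdges adj C).val.Nodup := by
  rw [(listComponentEdges_perm adj C).nodup_iff, List.nodup_flatMap]
  refine ⟨fun u hu => ((hadj u hu).filter _).map (Prod.mk_right_injective u), ?_⟩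
  refine hC.imp fun {a b} hab => ?_
  rw [Function.onFun, List.disjoint_left]
  intro e h1 h2
  rw [List.mem_map] at h1 h2
  obtain ⟨x, -, rfl⟩ := h1
  obtain ⟨y, -, h⟩ := h2
  exact hab (Prod.ext_iff.1 h).1.symm

theorem length_listComponentEdges_le (adj : Fin n → List (Fin n)) (C : List (Fin n)) (D : ℕ)
    (hD : ∀ u ∈ C, (adj u).length ≤ D) : (listComponentEdges adj C).val.length ≤ C.length * D := by
  rw [(listComponentEdges_perm adj C).length_eq, List.length_flatMap]
  refine (List.sum_le_card_nsmul _ D ?_).trans (by simp)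
  intro m hm
  rw [List.mem_map] at hm
  obtain ⟨u, hu, rfl⟩ := hm
  rw [List.length_map]
  exact (List.length_filter_le _ _).trans (hD u hu)

/-- A path repeats no vertex, so `n` rounds of search exhaust a component. -/
theorem reachable_iff_edist_le (H : SimpleGraph (Fin n)) (u w : Fin n) :
    H.Reachable u w ↔ H.edist u w ≤ n := by
  constructor
  · intro h
    obtain ⟨p, hp⟩ := h.exists_isPath
    refine (SimpleGraph.edist_le p).trans (Nat.cast_le.2 ?_)
    have := hp.length_lt
    rw [Fintype.card_fin] at this
    exact this.le
  · intro h
    rw [← SimpleGraph.edist_ne_top_iff_reachable]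
    exact ne_top_of_le_ne_top (ENat.natCast_ne_top n) h

end

variable {n q : ℕ} (M : PairwiseMRF n q)

theorem mem_nbrs {u v : Fin n} : v ∈ M.nbrs u ↔ M.graph.Adj u v := by simp [nbrs]

theorem nodup_nbrs (u : Fin n) : (M.nbrs u).Nodup := (List.nodup_finRange n).filter _

theorem length_nbrs_le {ρ : ℕ} (h : doublingDim M.graph ≤ (ρ : ℕ∞)) (u : Fin n) :
    (M.nbrs u).length + 1 ≤ 2 ^ ρ := by
  rw [← List.toFinset_card_of_nodup (M.nodup_nbrs u)]
  exact card_lt_of_forall_adj h u _ fun w hw => M.mem_nbrs.1 (List.mem_toFinset.1 hw)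

theorem listEdges_eq : M.listEdges = listComponentEdges M.nbrs (List.finRange n) := rfl

theorem nodup_listEdges : M.listEdges.val.Nodup :=
  nodup_listComponentEdges _ _ (List.nodup_finRange n) fun u _ => M.nodup_nbrs u

theorem mem_listEdges {e : Fin n × Fin n} : e ∈ M.listEdges.val ↔ e ∈ edgePairs M.graph := by
  rw [listEdges_eq, mem_listComponentEdges, mem_edgePairs, mem_nbrs]
  simp [and_comm]

theorem toFinset_listEdges : M.listEdges.val.toFinset = edgePairs M.graph := by
  ext e
  rw [List.mem_toFinset, mem_listEdges]

theorem mem_edgeNbrs {e f : Fin n × Fin n} : f ∈ M.edgeNbrs e ↔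
    f ∈ edgePairs M.graph ∧ ∃ w, IsEndpoint w e ∧ IsEndpoint w f := by
  have key : ∀ w, f ∈ (M.nbrs w).map (mkEdge w) ↔ f ∈ edgePairs M.graph ∧ IsEndpoint w f := by
    intro w
    rw [List.mem_map]
    constructor
    · rintro ⟨v, hv, rfl⟩
      exact ⟨mkEdge_mem_edgePairs (M.mem_nbrs.1 hv), isEndpoint_mkEdge.2 (Or.inl rfl)⟩
    · rintro ⟨hf, rfl | rfl⟩
      · exact ⟨f.2, M.mem_nbrs.2 (mem_edgePairs.1 hf).2, mkEdge_of_lt (mem_edgePairs.1 hf).1⟩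
      · exact ⟨f.1, M.mem_nbrs.2 (mem_edgePairs.1 hf).2.symm, by
          rw [mkEdge_comm, mkEdge_of_lt (mem_edgePairs.1 hf).1]⟩
  rw [edgeNbrs, List.mem_append, key, key]
  constructor
  · rintro (⟨h1, h2⟩ | ⟨h1, h2⟩)
    exacts [⟨h1, _, Or.inl rfl, h2⟩, ⟨h1, _, Or.inr rfl, h2⟩]
  · rintro ⟨h1, w, rfl | rfl, h2⟩
    exacts [Or.inl ⟨h1, h2⟩, Or.inr ⟨h1, h2⟩]

theorem length_edgeNbrs_le {ρ : ℕ} (h : doublingDim M.graph ≤ (ρ : ℕ∞)) (e : Fin n × Fin n) :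
    (M.edgeNbrs e).length ≤ 2 * 2 ^ ρ := by
  have h1 := M.length_nbrs_le h e.1
  have h2 := M.length_nbrs_le h e.2
  rw [edgeNbrs, List.length_append, List.length_map, List.length_map]
  omega

/-- Equality with `f` is split off because the list of `f` contains `f`. Reachability from a true
edge ensures that `f` is one too; other pairs are isolated in `edgeGraph` but may have nonempty
lists. -/
theorem edgeNbrs_spec {e : Fin n × Fin n} (he : e ∈ edgePairs M.graph) (f : Fin n × Fin n)
    (hf : (edgeGraph M.graph).Reachable e f) (g : Fin n × Fin n) :
    (g ∈ M.edgeNbrs f ∨ g = f) ↔ ((edgeGraph M.graph).Adj f g ∨ g = f) := by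
  have hfE : f ∈ edgePairs M.graph := by
    obtain ⟨j, hj⟩ := ENat.ne_top_iff_exists.1 (SimpleGraph.edist_ne_top_iff_reachable.2 hf)
    exact (edist_endpoint_le he hj.symm.le).1
  rw [mem_edgeNbrs, edgeGraph_adj_iff]
  by_cases hgf : g = f
  · simp [hgf]
  · simp only [hgf, or_false, ne_eq, hfE, true_and]
    exact ⟨fun h => ⟨fun h' => hgf h'.symm, h⟩, fun h => h.2⟩

variable (B : Finset (Fin n × Fin n))

theorem pruneNbrs_val (u : Fin n) :
    (M.pruneNbrs B).val u = ((M.nbrs u).filter fun v => mkEdge u v ∉ B).reverse := by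
  change (Timed.filter _ _).val = _
  rw [Timed.filter_val]

theorem mem_pruneNbrs {u v : Fin n} :
    v ∈ (M.pruneNbrs B).val u ↔ (removeEdges M.graph B).Adj u v := by
  rw [pruneNbrs_val, List.mem_reverse, List.mem_filter, mem_nbrs, decide_eq_true_eq]
  rfl

theorem nodup_pruneNbrs (u : Fin n) : ((M.pruneNbrs B).val u).Nodup := by
  rw [pruneNbrs_val, List.nodup_reverse]
  exact (M.nodup_nbrs u).filter _

theorem length_pruneNbrs_le (u : Fin n) :
    ((M.pruneNbrs B).val u).length ≤ (M.nbrs u).length := by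
  rw [pruneNbrs_val, List.length_reverse]
  exact List.length_filter_le _ _

theorem pruneNbrs_time : (M.pruneNbrs B).time = ∑ u, ((M.nbrs u).length + 1) := by
  change ∑ u : Fin n, ((Timed.filter _ _).time + 1) = _
  simp_rw [Timed.filter_time]

theorem computeWeight_val (C : List (Fin n)) (F : List (Fin n × Fin n)) (x : Fin n → Fin q) :
    (M.computeWeight C F x).val = Real.exp ((C.map fun v => M.nodePot v (x v)).sum +
      (F.map fun e => M.edgePot e.1 e.2 (x e.1) (x e.2)).sum) := by
  simp only [computeWeight, Timed.bind_val, Timed.pure_val, Timed.sumOver_val]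

theorem computeWeight_time_le (C : List (Fin n)) (F : List (Fin n × Fin n)) (x : Fin n → Fin q) :
    (M.computeWeight C F x).time ≤ C.length + F.length + 1 := by
  have h1 := Timed.sumOver_time_le C (fun v => pure (M.nodePot v (x v))) 0 (by simp)
  have h2 := Timed.sumOver_time_le F
    (fun e => pure (M.edgePot e.1 e.2 (x e.1) (x e.2))) 0 (by simp)
  simp only [computeWeight, Timed.bind_time, Timed.pure_time, Timed.tick_time]
  omega

open Classical in
theorem sumAssignments_val (weight : (Fin n → Fin q) → Timed ℝ) (L : List (Fin n)) (hL : L.Nodup)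
    (x : Fin n → Fin q) : (sumAssignments weight L x).val =
      ∑ y : Fin n → Fin q, if ∀ v, v ∉ L → y v = x v then (weight y).val else 0 := by
  induction L generalizing x with
  | nil =>
    rw [Finset.sum_eq_single x]
    · simp [sumAssignments]
    · intro y _ hy
      rw [if_neg]
      exact fun h => hy (funext fun v => h v (by simp))
    · simp
  | cons v L ih =>
    obtain ⟨hv, hL⟩ := List.nodup_cons.1 hL
    rw [sumAssignments, Timed.sumOver_val, ← List.ofFn_eq_map, List.sum_ofFn]
    simp_rw [ih hL]
    rw [Finset.sum_comm]
    refine Finset.sum_congr rfl fun y _ => ?_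
    -- An assignment `y` is met in exactly one branch of the recursion, the one that sets `v` to `y
    -- v`.
    rw [Finset.sum_eq_single (y v)]
    · refine if_congr ⟨fun h w hw => ?_, fun h w hw => ?_⟩ rfl rfl
      · rw [List.mem_cons, not_or] at hw
        rw [h w hw.2, Function.update_of_ne hw.1]
      · by_cases hwv : w = v
        · subst hwv; rw [Function.update_self]
        · rw [Function.update_of_ne hwv]
          exact h w (by simp [hwv, hw])
    · intro a _ ha
      rw [if_neg]
      intro h
      have := h v hv
      rw [Function.update_self] at this
      exact ha this.symm
    · simp

theorem sumAssignments_time_le (weight : (Fin n → Fin q) → Timed ℝ) (c : ℕ) (hq : 1 ≤ q)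
    (hc : ∀ x, (weight x).time ≤ c) (L : List (Fin n)) (x : Fin n → Fin q) :
    (sumAssignments weight L x).time ≤ q ^ L.length * (c + L.length) := by
  induction L generalizing x with
  | nil => simpa [sumAssignments] using hc x
  | cons v L ih =>
    rw [sumAssignments]
    refine (Timed.sumOver_time_le _ _ (q ^ L.length * (c + L.length)) fun a _ => ih _).trans ?_
    rw [List.length_finRange, List.length_cons, pow_succ]
    -- The loop overhead of one step per letter is absorbed by the growth of the second factor, as
    -- `1 ≤ q ^ L.length`.
    have := Nat.one_le_pow L.length q hq
    nlinarith [Nat.mul_le_mul_left q this]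

end PairwiseMRF

namespace PairwiseMRF

variable {n q : ℕ} [NeZero q] (M : PairwiseMRF n q) (B : Finset (Fin n × Fin n))

/-- The node list of the component of `v`, as found by breadth first search. -/
def componentList {n : ℕ} (adj : Fin n → List (Fin n)) (v : Fin n) : List (Fin n) :=
  (bfs adj n ([v], [v])).val.1

omit [NeZero q] in
theorem componentList_spec (v : Fin n) :
    (componentList (M.pruneNbrs B).val v).Nodup ∧ ∀ w,
      w ∈ componentList (M.pruneNbrs B).val v ↔ (removeEdges M.graph B).Reachable v w := by
  obtain ⟨h1, h2, -⟩ := bfs_spec (removeEdges M.graph B) (M.pruneNbrs B).val v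
    (fun w _ x => by rw [M.mem_pruneNbrs B]) n
  exact ⟨h1, fun w => (h2 w).trans (reachable_iff_edist_le _ _ _).symm⟩

/-- Exhaustive summation over a component. -/
theorem sumAssignments_component (v : Fin n) {S : Finset (Fin n)} (hS : S ∈ M.components B)
    (hv : v ∈ S) :
    (sumAssignments (M.computeWeight (componentList (M.pruneNbrs B).val v)
      (listComponentEdges (M.pruneNbrs B).val (componentList (M.pruneNbrs B).val v)).val)
      (componentList (M.pruneNbrs B).val v) (fun _ => 0)).val = M.restrictedPartitionFn B S := by
  classical
  set C := componentList (M.pruneNbrs B).val v with hC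
  set F := (listComponentEdges (M.pruneNbrs B).val C).val with hF
  obtain ⟨hnd, hmem⟩ := M.componentList_spec B v
  rw [← hC] at hnd hmem
  have hCS : ∀ w, w ∈ C ↔ w ∈ S := fun w => (hmem w).trans (mem_of_mem_components hS hv).symm
  have hCS' : C.toFinset = S := by ext w; rw [List.mem_toFinset, hCS]
  have hFnd : F.Nodup := nodup_listComponentEdges _ _ hnd fun u _ => M.nodup_pruneNbrs B u
  have hweight : ∀ y, (M.computeWeight C F y).val = Real.exp (M.restrictedEnergy B S y) := by
    intro y
    rw [computeWeight_val, restrictedEnergy, ← List.sum_toFinset _ hnd, hCS',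
      ← List.sum_toFinset _ hFnd, ← Finset.sum_product', ← Finset.sum_filter]
    congr 2
    refine Finset.sum_congr ?_ fun _ _ => rfl
    ext e
    rw [List.mem_toFinset, hF, mem_listComponentEdges, mem_pruneNbrs, hCS, Finset.mem_filter,
      Finset.mem_product]
    simp [and_comm]
  rw [sumAssignments_val _ _ hnd, M.restrictedPartitionFn_eq B hS
    (fun x v => if h : v ∈ S then x ⟨v, h⟩ else 0) (fun x v => by simp), ← Finset.sum_filter]
  symm
  -- The default `0` off `S` is the value of the assignment from which the exhaustive summation
  -- starts.
  refine Finset.sum_bij (fun x _ v => if h : v ∈ S then x ⟨v, h⟩ else 0) ?_ ?_ ?_ ?_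
  · intro x _
    rw [Finset.mem_filter]
    refine ⟨Finset.mem_univ _, fun w hw => ?_⟩
    rw [hCS] at hw
    simp [hw]
  · intro x _ y _ hxy
    funext ⟨w, hw⟩
    simpa [hw] using congrFun hxy w
  · intro y hy
    refine ⟨fun w => y w, Finset.mem_univ _, ?_⟩
    funext w
    by_cases hw : w ∈ S
    · simp [hw]
    · have := (Finset.mem_filter.1 hy).2 w (by rwa [hCS])
      simp [hw, this]
  · intro x _
    rw [hweight]

theorem sumLogComponents_val : (M.sumLogComponents (M.pruneNbrs B).val).val =
    ∑ S ∈ M.components B, Real.log (M.restrictedPartitionFn B S) := by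
  classical
  set adj := (M.pruneNbrs B).val with hadj
  -- Loop invariant: for some set `𝒯` of components, the marked nodes are their union and the
  -- accumulated sum runs over `𝒯`. An unmarked node thus belongs to a new component.
  have key : ∀ (l : List (Fin n)) (st : Finset (Fin n) × ℝ) (𝒯 : Finset (Finset (Fin n))),
      𝒯 ⊆ M.components B → st.1 = 𝒯.biUnion id →
      st.2 = ∑ S ∈ 𝒯, Real.log (M.restrictedPartitionFn B S) →
      ∃ 𝒯' : Finset (Finset (Fin n)), 𝒯 ⊆ 𝒯' ∧ 𝒯' ⊆ M.components B ∧
        (∀ v ∈ l, ∃ S ∈ 𝒯', v ∈ S) ∧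
        (Timed.foldl (fun (st : Finset (Fin n) × ℝ) v =>
          if v ∈ st.1 then pure st
          else do
            let c ← bfs adj n ([v], [v])
            let seen ← Timed.foldl (fun X w => pure (insert w X)) st.1 c.1
            let F ← listComponentEdges adj c.1
            let z ← sumAssignments (M.computeWeight c.1 F) c.1 (fun _ => 0)
            Timed.tick 1
            pure (seen, st.2 + Real.log z)) st l).val.2
          = ∑ S ∈ 𝒯', Real.log (M.restrictedPartitionFn B S) := by
    intro l
    induction l with
    | nil => intro st 𝒯 h1 h2 h3; exact ⟨𝒯, subset_rfl, h1, by simp, h3⟩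
    | cons v l ih =>
      intro st 𝒯 h1 h2 h3
      rw [Timed.foldl_cons_val]
      by_cases hv : v ∈ st.1
      · rw [if_pos hv, Timed.pure_val]
        obtain ⟨𝒯', k1, k2, k3, k4⟩ := ih st 𝒯 h1 h2 h3
        refine ⟨𝒯', k1, k2, ?_, k4⟩
        intro w hw
        rcases List.mem_cons.1 hw with rfl | hw
        · rw [h2, Finset.mem_biUnion] at hv
          obtain ⟨S, hS, hwS⟩ := hv
          exact ⟨S, k1 hS, hwS⟩
        · exact k3 w hw
      · rw [if_neg hv]
        simp only [Timed.bind_val, Timed.pure_val]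
        obtain ⟨S, hS, hvS⟩ := M.exists_mem_components B v
        have hST : S ∉ 𝒯 := fun h => hv (by
          rw [h2, Finset.mem_biUnion]; exact ⟨S, h, hvS⟩)
        have hcS : (componentList adj v).toFinset = S := by
          ext w
          rw [List.mem_toFinset, (M.componentList_spec B v).2, mem_of_mem_components hS hvS]
        obtain ⟨𝒯', k1, k2, k3, k4⟩ := ih
          (st.1 ∪ (componentList adj v).toFinset,
            st.2 + Real.log (sumAssignments (M.computeWeight (componentList adj v)
              (listComponentEdges adj (componentList adj v)).val)
              (componentList adj v) (fun _ => 0)).val) (insert S 𝒯)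
          (Finset.insert_subset hS h1)
          (by rw [hcS, h2, Finset.biUnion_insert, id, Finset.union_comm])
          (by rw [M.sumAssignments_component B v hS hvS, Finset.sum_insert hST, h3, add_comm])
        refine ⟨𝒯', (Finset.subset_insert _ _).trans k1, k2, ?_, ?_⟩
        · intro w hw
          rcases List.mem_cons.1 hw with rfl | hw
          · exact ⟨S, k1 (Finset.mem_insert_self _ _), hvS⟩
          · exact k3 w hw
        · rw [← k4, Timed.foldl_insert_toFinset]
          rfl
  obtain ⟨𝒯', -, k2, k3, k4⟩ := key (List.finRange n) (∅, 0) ∅ (by simp) (by simp) (by simp)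
  have h𝒯 : 𝒯' = M.components B := by
    refine Finset.Subset.antisymm k2 fun S hS => ?_
    obtain ⟨v, hv⟩ := (M.mem_components B).1 hS
    have hvS : v ∈ S := (hv v).2 (SimpleGraph.Reachable.refl v)
    obtain ⟨T, hT, hvT⟩ := k3 v (by simp)
    rwa [components_eq hS (k2 hT) hvS hvT]
  rw [← h𝒯, ← k4]
  rfl

end PairwiseMRF

/-- A scan for a minimum or maximum is determined by its lower or upper bounds `c`. Keeping `R`
abstract serves both orders and both of the nested loops. -/
theorem Timed.rel_foldl_iff {α : Type} (R : ℝ → ℝ → Prop) (f : ℝ → α → Timed ℝ)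
    (P : α → ℝ → Prop) (h : ∀ m a c, R c (f m a).val ↔ R c m ∧ P a c) (m : ℝ) (l : List α)
    (c : ℝ) : R c (Timed.foldl f m l).val ↔ R c m ∧ ∀ a ∈ l, P a c := by
  induction l generalizing m with
  | nil => simp [Timed.foldl_nil]
  | cons a l ih =>
    rw [Timed.foldl_cons_val, ih, h, List.forall_mem_cons, and_assoc]

namespace PairwiseMRF

variable {n q : ℕ} [NeZero q] (M : PairwiseMRF n q)

theorem computeEdgeMin_val (e : Fin n × Fin n) : (M.computeEdgeMin e).val = M.edgeMin e := by
  refine eq_of_forall_le_iff fun c => ?_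
  rw [computeEdgeMin, Timed.rel_foldl_iff (· ≤ ·) _ (fun a c => ∀ b, c ≤ M.edgePot e.1 e.2 a b),
    edgeMin, Finset.le_inf'_iff]
  · simp only [List.mem_finRange, forall_true_left, Finset.mem_univ, Prod.forall]
    -- The starting value of the scan is a table entry, so it imposes no extra condition.
    exact ⟨fun h => h.2, fun h => ⟨h 0 0, h⟩⟩
  · intro m a c
    rw [Timed.rel_foldl_iff (· ≤ ·) _ (fun b c => c ≤ M.edgePot e.1 e.2 a b)]
    · simp
    · intro m b c
      rw [Timed.pure_val, le_min_iff]

theorem computeEdgeMax_val (e : Fin n × Fin n) : (M.computeEdgeMax e).val = M.edgeMax e := by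
  refine eq_of_forall_ge_iff fun c => ?_
  rw [computeEdgeMax, Timed.rel_foldl_iff (fun c m => m ≤ c) _
    (fun a c => ∀ b, M.edgePot e.1 e.2 a b ≤ c), edgeMax, Finset.sup'_le_iff]
  · simp only [List.mem_finRange, forall_true_left, Finset.mem_univ, Prod.forall]
    exact ⟨fun h => h.2, fun h => ⟨h 0 0, h⟩⟩
  · intro m a c
    rw [Timed.rel_foldl_iff (fun c m => m ≤ c) _ (fun b c => M.edgePot e.1 e.2 a b ≤ c)]
    · simp
    · intro m b c
      rw [Timed.pure_val, max_le_iff]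

theorem computeBounds_val {B : Finset (Fin n × Fin n)} (hB : B ⊆ edgePairs M.graph) :
    (M.computeBounds M.listEdges.val B).val = (M.logLowerBound B, M.logUpperBound B) := by
  have hmem : (Timed.filter (fun e => e ∈ B) M.listEdges.val).val.toFinset = B := by
    ext e
    rw [Timed.filter_val, List.mem_toFinset, List.mem_reverse, List.mem_filter, mem_listEdges]
    simp only [decide_eq_true_eq, and_iff_right_iff_imp]
    exact fun h => hB h
  have hnd : (Timed.filter (fun e => e ∈ B) M.listEdges.val).val.Nodup := by
    rw [Timed.filter_val, List.nodup_reverse]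
    exact M.nodup_listEdges.filter _
  simp only [computeBounds, Timed.bind_val, Timed.pure_val, Timed.sumOver_val,
    computeEdgeMin_val, computeEdgeMax_val, sumLogComponents_val]
  rw [← List.sum_toFinset _ hnd, ← List.sum_toFinset _ hnd, hmem]
  rfl

/-- The implementation returns the random pair of bounds. -/
theorem logPartition_output (p : ℝ) (k : ℕ) : (M.logPartition p k).output =
    (dbDim (edgeGraph M.graph) p k (edgePairs M.graph)).map
      (fun B => (M.logLowerBound B, M.logUpperBound B)) := by
  unfold logPartition
  rw [RandTimed.output_lift_bind, RandTimed.output_bind,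
    dbDimRun_output (edgeGraph M.graph) M.edgeNbrs M.listEdges.val
      (fun e he f hf g => M.edgeNbrs_spec (M.mem_listEdges.1 he) f hf g),
    toFinset_listEdges, ← PMF.bind_pure_comp]
  refine PMF.bind_congr_of_mem_support _ _ _ fun B hB => ?_
  rw [RandTimed.output_lift, M.computeBounds_val (dbDim_support_subset _ _ _ _ _ hB)]
  rfl

end PairwiseMRF

/-! ### The running time in terms of `n`, `ρ`, `q` and `k`. -/

namespace PairwiseMRF

variable {n q : ℕ} [NeZero q] (M : PairwiseMRF n q)

theorem computeEdgeMin_time_le (e : Fin n × Fin n) : (M.computeEdgeMin e).time ≤ q * (1 + q) := by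
  refine (Timed.foldl_time_le _ q _ _ fun m a _ => ?_).trans (by rw [List.length_finRange])
  rw [Timed.foldl_pure_time, List.length_finRange]

theorem computeEdgeMax_time_le (e : Fin n × Fin n) : (M.computeEdgeMax e).time ≤ q * (1 + q) := by
  refine (Timed.foldl_time_le _ q _ _ fun m a _ => ?_).trans (by rw [List.length_finRange])
  rw [Timed.foldl_pure_time, List.length_finRange]

variable {ρ : ℕ}

/-- The time for all components, if these have at most `s` nodes. -/
theorem sumLogComponents_time_le (h : doublingDim M.graph ≤ (ρ : ℕ∞)) (B : Finset (Fin n × Fin n))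
    (s : ℕ) (hs : ∀ (v : Fin n) (S : Finset (Fin n)),
      (∀ w ∈ S, (removeEdges M.graph B).Reachable v w) → S.card ≤ s) :
    (M.sumLogComponents (M.pruneNbrs B).val).time ≤
      n * (1 + (1 + (2 + 2 ^ ρ) * s + (s + (s * (1 + 2 ^ ρ) +
        (q ^ s * (s + s * 2 ^ ρ + 1 + s) + 1))))) := by
  set adj := (M.pruneNbrs B).val with hadj
  have hD : ∀ u, (adj u).length ≤ 2 ^ ρ := fun u =>
    (M.length_pruneNbrs_le B u).trans ((Nat.le_succ _).trans (M.length_nbrs_le h u))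
  have hq : 1 ≤ q := Nat.one_le_iff_ne_zero.2 (NeZero.ne q)
  unfold sumLogComponents
  simp only [Timed.bind_time, Timed.pure_time, Nat.add_zero]
  -- Every node is charged as if it opened a new component, which accounts for the factor `n`.
  refine (Timed.foldl_time_le _ (1 + (2 + 2 ^ ρ) * s + (s + (s * (1 + 2 ^ ρ) +
        (q ^ s * (s + s * 2 ^ ρ + 1 + s) + 1)))) _ _ fun st v _ => ?_).trans
    (by rw [List.length_finRange])
  split_ifs with hv
  · simp
  have hlen : (bfs adj n ([v], [v])).val.1.length ≤ s := by
    obtain ⟨h1, h2⟩ := M.componentList_spec B v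
    have := hs v (componentList adj v).toFinset fun w hw => (h2 w).1 (List.mem_toFinset.1 hw)
    rwa [List.toFinset_card_of_nodup h1] at this
  have hbfs := (bfs_time_le adj (2 ^ ρ) n [v] [v] hD (by simp))
  simp only [Timed.bind_time, Timed.pure_time, Timed.tick_time, Timed.foldl_pure_time]
  set C := (bfs adj n ([v], [v])).val.1 with hC
  have e1 : C.length - [v].length + [v].length = C.length := Nat.sub_add_cancel hbfs.1
  rw [e1] at hbfs
  have h1 : (bfs adj n ([v], [v])).time ≤ 1 + (2 + 2 ^ ρ) * s :=
    hbfs.2.trans (Nat.add_le_add_left (Nat.mul_le_mul_left _ hlen) _)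
  have h2 : (listComponentEdges adj C).time ≤ s * (1 + 2 ^ ρ) :=
    (listComponentEdges_time adj C (2 ^ ρ) fun u _ => hD u).trans (Nat.mul_le_mul_right _ hlen)
  have h3 : (listComponentEdges adj C).val.length ≤ s * 2 ^ ρ :=
    (length_listComponentEdges_le adj C (2 ^ ρ) fun u _ => hD u).trans
      (Nat.mul_le_mul_right _ hlen)
  have h4 : (sumAssignments (M.computeWeight C (listComponentEdges adj C).val) C
      (fun _ => 0)).time ≤ q ^ s * (s + s * 2 ^ ρ + 1 + s) := by
    refine (sumAssignments_time_le _ (s + s * 2 ^ ρ + 1) hq (fun x => ?_) C _).trans ?_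
    · exact (M.computeWeight_time_le C _ x).trans (by omega)
    · exact Nat.mul_le_mul (Nat.pow_le_pow_right hq hlen) (by omega)
  simp only [Nat.add_zero]
  gcongr

theorem computeBounds_time_le (h : doublingDim M.graph ≤ (ρ : ℕ∞)) (E : List (Fin n × Fin n))
    (B : Finset (Fin n × Fin n))
    (s : ℕ) (hs : ∀ (v : Fin n) (S : Finset (Fin n)),
      (∀ w ∈ S, (removeEdges M.graph B).Reachable v w) → S.card ≤ s) :
    (M.computeBounds E B).time ≤ n * 2 ^ ρ + n * (1 + (1 + (2 + 2 ^ ρ) * s + (s +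
        (s * (1 + 2 ^ ρ) + (q ^ s * (s + s * 2 ^ ρ + 1 + s) + 1))))) + E.length +
      2 * (E.length * (1 + q * (1 + q))) + 1 := by
  have h1 : (M.pruneNbrs B).time ≤ n * 2 ^ ρ := by
    rw [pruneNbrs_time]
    exact (Finset.sum_le_sum fun u _ => M.length_nbrs_le h u).trans (by simp)
  have h2 := M.sumLogComponents_time_le h B s hs
  have hR : (Timed.filter (fun e => e ∈ B) E).val.length ≤ E.length := by
    rw [Timed.filter_val, List.length_reverse]
    exact List.length_filter_le _ _
  have h3 := (Timed.sumOver_time_le (Timed.filter (fun e => e ∈ B) E).val M.computeEdgeMin _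
    fun e _ => M.computeEdgeMin_time_le e).trans (Nat.mul_le_mul_right _ hR)
  have h4 := (Timed.sumOver_time_le (Timed.filter (fun e => e ∈ B) E).val M.computeEdgeMax _
    fun e _ => M.computeEdgeMax_time_le e).trans (Nat.mul_le_mul_right _ hR)
  simp only [computeBounds, Timed.bind_time, Timed.pure_time, Timed.tick_time, Timed.filter_time]
  omega

omit [NeZero q] in
theorem length_listEdges_le (h : doublingDim M.graph ≤ (ρ : ℕ∞)) :
    M.listEdges.val.length ≤ n * 2 ^ ρ := by
  refine (length_listComponentEdges_le M.nbrs (List.finRange n) (2 ^ ρ) fun u _ => ?_).trans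
    (by rw [List.length_finRange])
  exact (Nat.le_succ _).trans (M.length_nbrs_le h u)

omit [NeZero q] in
/-- The time of the breadth first searches of `Db-dim`. -/
theorem bfs_edgeNbrs_time_le (h : doublingDim M.graph ≤ (ρ : ℕ∞)) {k : ℕ} {e : Fin n × Fin n}
    (he : e ∈ edgePairs M.graph) {Q : ℕ} (hQ : Q ≤ k + 1) :
    (bfs M.edgeNbrs Q ([e], [e])).time + ((bfs M.edgeNbrs Q ([e], [e])).val.2.length +
      (bfs M.edgeNbrs Q ([e], [e])).val.1.length) ≤
      1 + (2 + 2 * 2 ^ ρ) * (4 * (k + 3)) ^ ρ + 2 * (4 * (k + 3)) ^ ρ := by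
  obtain ⟨h1, h2, -, -, h5⟩ := bfs_spec (edgeGraph M.graph) M.edgeNbrs e (M.edgeNbrs_spec he) Q
  have hbfs := bfs_time_le M.edgeNbrs (2 * 2 ^ ρ) Q [e] [e] (M.length_edgeNbrs_le h) (by simp)
  set C := (bfs M.edgeNbrs Q ([e], [e])).val.1 with hC
  have hlen : C.length ≤ (4 * (k + 3)) ^ ρ := by
    have := card_edges_le_of_edist_le h he (k + 1) C.toFinset fun f hf =>
      ((h2 f).1 (List.mem_toFinset.1 hf)).trans (Nat.cast_le.2 hQ)
    rwa [List.toFinset_card_of_nodup h1] at this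
  have e1 : C.length - [e].length + [e].length = C.length := Nat.sub_add_cancel hbfs.1
  rw [e1] at hbfs
  have := Nat.mul_le_mul_left (2 + 2 * 2 ^ ρ) hlen
  omega

theorem logPartition_time_le (h : doublingDim M.graph ≤ (ρ : ℕ∞)) (p : ℝ) (k : ℕ) :
    ∀ t ∈ (M.logPartition p k).runningTimes,
      t ≤ n * (1 + 2 ^ ρ) + (M.listEdges.val.length * (2 + k +
          (1 + (2 + 2 * 2 ^ ρ) * (4 * (k + 3)) ^ ρ + 2 * (4 * (k + 3)) ^ ρ)) + 1) +
        (n * 2 ^ ρ + n * (1 + (1 + (2 + 2 ^ ρ) * (2 * (k + 2)) ^ ρ + ((2 * (k + 2)) ^ ρ +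
        ((2 * (k + 2)) ^ ρ * (1 + 2 ^ ρ) + (q ^ ((2 * (k + 2)) ^ ρ) *
          ((2 * (k + 2)) ^ ρ + (2 * (k + 2)) ^ ρ * 2 ^ ρ + 1 + (2 * (k + 2)) ^ ρ) + 1))))) +
        M.listEdges.val.length + 2 * (M.listEdges.val.length * (1 + q * (1 + q))) + 1) := by
  rintro t ⟨r, hr, rfl⟩
  unfold logPartition at hr
  obtain ⟨r1, hr1, -, e1⟩ := RandTimed.mem_support_lift_bind hr
  obtain ⟨x, hx, r2, hr2, -, e2⟩ := RandTimed.mem_support_bind hr1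
  rw [RandTimed.mem_support_lift hr2] at e2
  -- The bound on the components needs the edge set to be a possible result of the abstract `dbDim`,
  -- which the equality of laws provides.
  have hB := RandTimed.val_mem_support_output hx
  rw [dbDimRun_output (edgeGraph M.graph) M.edgeNbrs M.listEdges.val
      (fun e he f hf g => M.edgeNbrs_spec (M.mem_listEdges.1 he) f hf g),
    toFinset_listEdges] at hB
  have h1 : M.listEdges.time ≤ n * (1 + 2 ^ ρ) := by
    rw [listEdges_eq]
    refine (listComponentEdges_time M.nbrs (List.finRange n) (2 ^ ρ) fun u _ => ?_).trans
      (by rw [List.length_finRange])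
    exact (Nat.le_succ _).trans (M.length_nbrs_le h u)
  have h2 := dbDimRun_time_le M.edgeNbrs M.listEdges.val p k _
    (fun e he Q hQ => M.bfs_edgeNbrs_time_le h (M.mem_listEdges.1 he) hQ) x hx
  have h3 := M.computeBounds_time_le h M.listEdges.val x.val _
    fun v S hS => card_component_le h p k hB v S hS
  rw [e1, e2, ← add_assoc]
  exact add_le_add (add_le_add h1 h2) h3

end PairwiseMRF

/-- Arithmetic of the time bound. -/
theorem time_bound_arith {n D A s k q Q m : ℕ} (hn : 1 ≤ n) (hD : 1 ≤ D) (hA : 1 ≤ A)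
    (hs : 1 ≤ s) (hqQ : q ≤ Q) (hQ : 1 ≤ Q) (hm : m ≤ n * D) :
    n * (1 + D) + (m * (2 + k + (1 + (2 + 2 * D) * A + 2 * A)) + 1) +
      (n * D + n * (1 + (1 + (2 + D) * s + (s + (s * (1 + D) +
        (q ^ s * (s + s * D + 1 + s) + 1))))) + m + 2 * (m * (1 + q * (1 + q))) + 1)
      ≤ 40 * (n * D * (D * A * (k + 2) * s * Q ^ s)) + 6 * (m * Q ^ 2) := by
  -- All terms are compared with the single monomial `n * D * P`, except those of the edge tables:
  -- the latter keep the factor `m`, since for `ρ = 0` a `Q ^ 2` would be too large and it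
  -- disappears through `m = 0`.
  set P := D * A * (k + 2) * s * Q ^ s with hP
  have hQs : 1 ≤ Q ^ s := Nat.one_le_pow _ _ hQ
  have hDA : 1 ≤ D * A := Nat.mul_pos hD hA
  have hAD : A ≤ D * A := Nat.le_mul_of_pos_left A hD
  have hP1 : D * A * (k + 2) ≤ P := by
    rw [hP, mul_assoc _ s]
    exact Nat.le_mul_of_pos_right _ (Nat.mul_pos hs hQs)
  have hP0 : 1 ≤ P := le_trans (Nat.mul_pos hDA (by omega)) hP1
  have hP2 : s * Q ^ s ≤ P := by
    rw [hP, mul_assoc _ s]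
    exact Nat.le_mul_of_pos_left _ (Nat.mul_pos hDA (by omega))
  have hP3 : s ≤ P := (Nat.le_mul_of_pos_right s hQs).trans hP2
  have hnD : 1 ≤ n * D := Nat.mul_pos hn hD
  have hnnD : n ≤ n * D := Nat.le_mul_of_pos_right n hD
  have hnDP : n * D ≤ n * D * P := Nat.le_mul_of_pos_right _ hP0
  have t1 : n * (1 + D) ≤ 2 * (n * D * P) := by rw [mul_add]; omega
  have t2 : m * (2 + k + (1 + (2 + 2 * D) * A + 2 * A)) ≤ 8 * (n * D * P) := by
    have h1 : 2 + k + (1 + (2 + 2 * D) * A + 2 * A) ≤ 8 * (D * A * (k + 2)) := by nlinarith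
    calc _ ≤ n * D * (8 * P) := Nat.mul_le_mul hm (h1.trans (Nat.mul_le_mul_left 8 hP1))
      _ = _ := by ring
  have t3 : n * (1 + (1 + (2 + D) * s + (s + (s * (1 + D) +
        (q ^ s * (s + s * D + 1 + s) + 1))))) ≤ 20 * (n * D * P) := by
    have h1 : q ^ s * (s + s * D + 1 + s) ≤ 4 * (D * (s * Q ^ s)) := by
      calc q ^ s * (s + s * D + 1 + s) ≤ Q ^ s * (4 * (D * s)) :=
            Nat.mul_le_mul (Nat.pow_le_pow_left hqQ s) (by nlinarith)
        _ = _ := by ring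
    have h2 : 1 + (1 + (2 + D) * s + (s + (s * (1 + D) + 1))) ≤ 10 * (D * s) := by nlinarith
    have h3 : D * (s * Q ^ s) ≤ D * P := Nat.mul_le_mul_left D hP2
    have h4 : D * s ≤ D * P := Nat.mul_le_mul_left D hP3
    calc _ ≤ n * (14 * (D * P)) := Nat.mul_le_mul_left n (by omega)
      _ ≤ _ := by nlinarith
  have t4 : m * (1 + q * (1 + q)) ≤ 3 * (m * Q ^ 2) := by
    have : 1 + q * (1 + q) ≤ 3 * Q ^ 2 := by nlinarith
    calc _ ≤ m * (3 * Q ^ 2) := Nat.mul_le_mul_left m this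
      _ = _ := by ring
  omega

/-! ### Estimates for `φ` and `K(φ, ρ)`, with `X = 24 ρ / φ`. -/

section Parameters

variable {ε : ℝ} {ρ : ℕ}

theorem dbPhi_eq (ε : ℝ) (ρ : ℕ) : dbPhi ε ρ = ε / (8 * 2 ^ ρ) := by
  have : (-(ρ : ℝ) - 3) = -((ρ + 3 : ℕ) : ℝ) := by push_cast; ring
  rw [dbPhi, this, Real.rpow_neg (by norm_num), Real.rpow_natCast, pow_add, div_eq_mul_inv,
    show (2 : ℝ) ^ ρ * 2 ^ 3 = 8 * 2 ^ ρ by ring]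

theorem dbPhi_pos (h : 0 < ε) (ρ : ℕ) : 0 < dbPhi ε ρ := by rw [dbPhi_eq]; positivity

theorem dbPhi_le (h1 : ε < 1) (hρ : 1 ≤ ρ) : dbPhi ε ρ ≤ 1 / 16 := by
  rw [dbPhi_eq, div_le_iff₀ (by positivity)]
  have : (2 : ℝ) ^ 1 ≤ 2 ^ ρ := pow_le_pow_right₀ (by norm_num) hρ
  linarith

theorem le_dbRadius_arg (h0 : 0 < ε) (h1 : ε < 1) (hρ : 1 ≤ ρ) :
    384 ≤ 24 * (ρ : ℝ) / dbPhi ε ρ := by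
  rw [le_div_iff₀ (dbPhi_pos h0 ρ)]
  have := dbPhi_le h1 hρ
  have : (1 : ℝ) ≤ ρ := by exact_mod_cast hρ
  linarith

theorem dbRadius_eq (φ : ℝ) (ρ : ℕ) :
    dbRadius φ ρ = 24 * ρ / φ / 2 * Real.log (24 * ρ / φ) := by
  rw [dbRadius]; ring

theorem two_le_log {x : ℝ} (hx : 384 ≤ x) : 2 ≤ Real.log x := by
  rw [Real.le_log_iff_exp_le (by linarith)]
  have h1 := Real.exp_one_lt_d9
  have h2 : Real.exp 2 = Real.exp 1 * Real.exp 1 := by rw [← Real.exp_add]; norm_num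
  rw [h2]
  nlinarith [Real.exp_pos 1]

theorem le_dbRadius (h0 : 0 < ε) (h1 : ε < 1) (hρ : 1 ≤ ρ) :
    24 * (ρ : ℝ) / dbPhi ε ρ ≤ dbRadius (dbPhi ε ρ) ρ := by
  have hX := le_dbRadius_arg h0 h1 hρ
  rw [dbRadius_eq]
  nlinarith [two_le_log hX]

theorem dbRadius_le_sq (h0 : 0 < ε) (h1 : ε < 1) (hρ : 1 ≤ ρ) :
    dbRadius (dbPhi ε ρ) ρ ≤ (24 * (ρ : ℝ) / dbPhi ε ρ) ^ 2 / 2 := by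
  have hX := le_dbRadius_arg h0 h1 hρ
  rw [dbRadius_eq]
  have := Real.log_le_self (x := 24 * (ρ : ℝ) / dbPhi ε ρ) (by linarith)
  nlinarith

theorem IsRounding.bounds {k : ℕ} {x : ℝ} (h : IsRounding k x) (hx : 0 ≤ x) :
    (k : ℝ) ≤ x + 1 ∧ x - 1 ≤ k := by
  rcases h with rfl | rfl
  · have h1 := Nat.floor_le hx
    have h2 := Nat.lt_floor_add_one x
    constructor <;> linarith
  · have h1 := Nat.ceil_lt_add_one hx
    have h2 := Nat.le_ceil x
    constructor <;> linarith

/-- The probability with which `Db-dim` truncates is small. -/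
theorem truncation_le (h0 : 0 < ε) (h1 : ε < 1) (hρ : 1 ≤ ρ) {k : ℕ}
    (hk : IsRounding k (dbRadius (dbPhi ε ρ) ρ)) :
    (1 - dbPhi ε ρ) ^ (k - 1) * (4 * ((k : ℝ) + 2)) ^ ρ ≤ dbPhi ε ρ := by
  set φ := dbPhi ε ρ with hφ
  have hφ0 : 0 < φ := dbPhi_pos h0 ρ
  have hφ1 : φ ≤ 1 / 16 := dbPhi_le h1 hρ
  set X := 24 * (ρ : ℝ) / φ with hXdef
  have hX : 384 ≤ X := le_dbRadius_arg h0 h1 hρ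
  have hX0 : 0 < X := by linarith
  have hK := le_dbRadius h0 h1 hρ
  have hK2 := dbRadius_le_sq h0 h1 hρ
  rw [← hφ, ← hXdef] at hK hK2
  obtain ⟨b1, b2⟩ := hk.bounds (by linarith)
  have hρ1 : (1 : ℝ) ≤ ρ := by exact_mod_cast hρ
  -- `K` is made so that `exp (-φ K) = X ^ (-12 ρ)`. Rounding and the `- 1` lose at most `2` in the
  -- exponent, hence a factor `exp (2 φ) ≤ exp (1 / 8) ≤ 2`.
  have e1 : (1 - φ) ^ (k - 1) ≤ 2 * (X ^ (12 * ρ))⁻¹ := by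
    have h2 : 1 - φ ≤ Real.exp (-φ) := Real.one_sub_le_exp_neg φ
    have h3 : (dbRadius φ ρ - 2 : ℝ) ≤ ((k - 1 : ℕ) : ℝ) := by
      have : 1 ≤ k := by
        have : (0 : ℝ) < k := by linarith
        exact_mod_cast this
      push_cast [this]
      linarith
    have h4 : -(φ * ((k - 1 : ℕ) : ℝ)) ≤ 1 / 8 + -(((12 * ρ : ℕ) : ℝ) * Real.log X) := by
      have h5 : φ * dbRadius φ ρ = ((12 * ρ : ℕ) : ℝ) * Real.log X := by
        rw [dbRadius, hXdef]; push_cast; field_simp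
      have h6 := mul_le_mul_of_nonneg_left h3 hφ0.le
      rw [← h5]
      nlinarith
    calc (1 - φ) ^ (k - 1) ≤ Real.exp (-φ) ^ (k - 1) :=
          pow_le_pow_left₀ (by linarith) h2 _
      _ = Real.exp (-(φ * ((k - 1 : ℕ) : ℝ))) := by rw [← Real.exp_nat_mul]; congr 1; ring
      _ ≤ Real.exp (1 / 8 + -(((12 * ρ : ℕ) : ℝ) * Real.log X)) := Real.exp_le_exp.2 h4
      _ = Real.exp (1 / 8) * (X ^ (12 * ρ))⁻¹ := by
          rw [Real.exp_add, Real.exp_neg, Real.exp_nat_mul, Real.exp_log hX0]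
      _ ≤ 2 * (X ^ (12 * ρ))⁻¹ := by
          refine mul_le_mul_of_nonneg_right ?_ (by positivity)
          have := Real.exp_bound_div_one_sub_of_interval (x := 1 / 8) (by norm_num) (by norm_num)
          linarith
  -- Since `k ≤ X ^ 2 / 2 + 1`, the base is at most `2 X ^ 2 + 12 ≤ X ^ 3`.
  have e2 : (4 * ((k : ℝ) + 2)) ^ ρ ≤ X ^ (3 * ρ) := by
    rw [pow_mul]
    refine pow_le_pow_left₀ (by positivity) ?_ ρ
    nlinarith [sq_nonneg X]
  have e3 : X ^ (3 * ρ) * (X ^ (12 * ρ))⁻¹ ≤ X⁻¹ := by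
    rw [← div_eq_mul_inv, div_le_iff₀ (by positivity), ← div_eq_inv_mul, le_div_iff₀ hX0,
      ← pow_succ]
    exact pow_le_pow_right₀ (by linarith) (by omega)
  calc (1 - φ) ^ (k - 1) * (4 * ((k : ℝ) + 2)) ^ ρ
      ≤ 2 * (X ^ (12 * ρ))⁻¹ * X ^ (3 * ρ) := by gcongr
    _ = 2 * (X ^ (3 * ρ) * (X ^ (12 * ρ))⁻¹) := by ring
    _ ≤ 2 * X⁻¹ := by gcongr
    _ ≤ φ := by
        rw [← div_eq_mul_inv, div_le_iff₀ hX0, hXdef]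
        field_simp
        linarith

/-- The factor `5` makes room for five powers `Q ^ A` with `A = (4 (k + 3)) ^ ρ`, into which the
whole time bound is packed. It suffices that `20 (k + 3) ≤ K ^ 2`, clear from `K ≥ 384`. -/
theorem radius_pow_le (h0 : 0 < ε) (h1 : ε < 1) (hρ : 1 ≤ ρ) {k : ℕ}
    (hk : IsRounding k (dbRadius (dbPhi ε ρ) ρ)) :
    5 * (4 * ((k : ℝ) + 3)) ^ ρ ≤ dbRadius (dbPhi ε ρ) ρ ^ (2 * ρ) := by
  have hX := le_dbRadius_arg h0 h1 hρ
  have hK := le_dbRadius h0 h1 hρ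
  set K := dbRadius (dbPhi ε ρ) ρ
  obtain ⟨b1, b2⟩ := hk.bounds (by linarith)
  calc 5 * (4 * ((k : ℝ) + 3)) ^ ρ ≤ 5 ^ ρ * (4 * ((k : ℝ) + 3)) ^ ρ := by
        refine mul_le_mul_of_nonneg_right ?_ (by positivity)
        simpa using pow_le_pow_right₀ (show (1 : ℝ) ≤ 5 by norm_num) hρ
    _ = (5 * (4 * ((k : ℝ) + 3))) ^ ρ := (mul_pow _ _ _).symm
    _ ≤ (K ^ 2) ^ ρ := pow_le_pow_left₀ (by positivity) (by nlinarith) ρ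
    _ = _ := by rw [pow_mul]

/-- The exponent of the running time is at most `exp (32 ρ (ρ + log (1 / ε)))`. -/
theorem radius_pow_le_exp (h0 : 0 < ε) (h1 : ε < 1) :
    dbRadius (dbPhi ε ρ) ρ ^ (2 * ρ) ≤ Real.exp (32 * (ρ * (ρ + Real.log (1 / ε)))) := by
  rcases Nat.eq_zero_or_pos ρ with rfl | hρ
  · simp
  have hX := le_dbRadius_arg h0 h1 hρ
  have hK := le_dbRadius h0 h1 hρ
  have hK2 := dbRadius_le_sq h0 h1 hρ
  set X := 24 * (ρ : ℝ) / dbPhi ε ρ with hXdef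
  have hX0 : 0 < X := by linarith
  have hρ1 : (1 : ℝ) ≤ ρ := by exact_mod_cast hρ
  have hl : 0 ≤ Real.log (1 / ε) := Real.log_nonneg (by rw [le_div_iff₀ h0]; linarith)
  have hXe : X ≤ Real.exp (8 * (ρ + Real.log (1 / ε))) := by
    -- The four factors are at most `exp 6`, `exp ρ`, `exp ρ` and `exp (log (1 / ε))`, and `6 ≤ 6
    -- ρ`.
    have e1 : X = 192 * ρ * 2 ^ ρ * (1 / ε) := by
      rw [hXdef, dbPhi_eq]; field_simp; norm_num
    have e2 : (192 : ℝ) ≤ Real.exp 6 := by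
      have := Real.exp_one_gt_d9
      calc (192 : ℝ) ≤ (2.7 : ℝ) ^ 6 := by norm_num
        _ ≤ Real.exp 1 ^ 6 := pow_le_pow_left₀ (by norm_num) (by linarith) 6
        _ = Real.exp 6 := by rw [← Real.exp_nat_mul]; norm_num
    have e3 : (ρ : ℝ) ≤ Real.exp ρ := by linarith [Real.add_one_le_exp (ρ : ℝ)]
    have e4 : (2 : ℝ) ^ ρ ≤ Real.exp ρ := by
      have := Real.exp_one_gt_d9
      calc (2 : ℝ) ^ ρ ≤ Real.exp 1 ^ ρ := pow_le_pow_left₀ (by norm_num) (by linarith) ρ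
        _ = Real.exp ρ := by rw [← Real.exp_nat_mul]; norm_num
    have e5 : 1 / ε = Real.exp (Real.log (1 / ε)) := (Real.exp_log (by positivity)).symm
    calc X = 192 * ρ * 2 ^ ρ * (1 / ε) := e1
      _ ≤ Real.exp 6 * Real.exp ρ * Real.exp ρ * Real.exp (Real.log (1 / ε)) := by
          rw [← e5]; gcongr
      _ = Real.exp (6 + ρ + ρ + Real.log (1 / ε)) := by simp only [Real.exp_add]
      _ ≤ _ := Real.exp_le_exp.2 (by linarith)
  calc dbRadius (dbPhi ε ρ) ρ ^ (2 * ρ)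
      ≤ (Real.exp (8 * (ρ + Real.log (1 / ε))) ^ 2) ^ (2 * ρ) := by
        refine pow_le_pow_left₀ (by linarith) (hK2.trans ?_) _
        have := pow_le_pow_left₀ hX0.le hXe 2
        nlinarith [sq_nonneg X]
    _ = _ := by
        rw [← pow_mul, ← Real.exp_nat_mul]
        congr 1
        push_cast
        ring

/-- Used to absorb the factor `2 ^ ρ` of the running time into the exponential factor. -/
theorem natCast_le_radius_pow (h0 : 0 < ε) (h1 : ε < 1) :
    (ρ : ℝ) ≤ dbRadius (dbPhi ε ρ) ρ ^ (2 * ρ) := by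
  rcases Nat.eq_zero_or_pos ρ with rfl | hρ
  · simp
  have hX := le_dbRadius_arg h0 h1 hρ
  have hK := le_dbRadius h0 h1 hρ
  calc (ρ : ℝ) ≤ 2 ^ ρ := by exact_mod_cast (Nat.lt_two_pow_self).le
    _ ≤ 2 ^ (2 * ρ) := pow_le_pow_right₀ (by norm_num) (by omega)
    _ ≤ _ := pow_le_pow_left₀ (by norm_num) (by linarith) _

end Parameters

/-! ### Assembly: time bound, expected gap, asymptotics. -/

namespace PairwiseMRF

variable {n q : ℕ} [NeZero q] (M : PairwiseMRF n q) {ρ : ℕ} {ε : ℝ} {k : ℕ}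

/-- The base `max q 2` covers the one-letter alphabet of the asymptotic statement and makes `A ≤ Q ^
A` available, by which polynomial factors move into the exponent. -/
theorem logPartition_time_le_rpow (hn : 1 ≤ n) (h : doublingDim M.graph ≤ (ρ : ℕ∞)) (h0 : 0 < ε)
    (h1 : ε < 1) (hk : IsRounding k (dbRadius (dbPhi ε ρ) ρ)) {t : ℕ}
    (ht : t ∈ (M.logPartition (dbPhi ε ρ) k).runningTimes) :
    (t : ℝ) ≤ 80 * (n * 2 ^ ρ *
      ((max q 2 : ℕ) : ℝ) ^ (dbRadius (dbPhi ε ρ) ρ ^ (2 * ρ))) := by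
  set Q := max q 2 with hQ
  have hQ2 : 2 ≤ Q := le_max_right _ _
  set m := M.listEdges.val.length with hm
  have hmle : m ≤ n * 2 ^ ρ := M.length_listEdges_le h
  have hbound := (M.logPartition_time_le h _ k t ht).trans
    (time_bound_arith (n := n) (D := 2 ^ ρ) (A := (4 * (k + 3)) ^ ρ) (s := (2 * (k + 2)) ^ ρ)
      (k := k) (q := q) (Q := Q) (m := m) hn Nat.one_le_two_pow (Nat.one_le_pow _ _ (by omega))
      (Nat.one_le_pow _ _ (by omega)) (le_max_left _ _) (by omega) hmle)
  -- For `ρ = 0` there are no edges and `k = 0`; the factor `k + 2 = 2` turns the constant `40` into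
  -- `80`.
  rcases Nat.eq_zero_or_pos ρ with rfl | hρ
  · have hk0 : k = 0 := by
      rcases hk with rfl | rfl <;> simp [dbRadius]
    have hm0 : m = 0 := by
      rw [hm, List.length_eq_zero_iff, List.eq_nil_iff_forall_not_mem]
      intro e he
      have := card_lt_of_forall_adj h e.1 {e.2} (by
        simpa using (mem_edgePairs.1 (M.mem_listEdges.1 he)).2)
      simp at this
    rw [hm0, hk0] at hbound
    simp only [pow_zero, mul_one, one_mul, zero_mul, mul_zero, pow_one, add_zero, Real.rpow_one]
      at hbound ⊢
    have : t ≤ 80 * (n * Q) := by nlinarith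
    exact_mod_cast this
  · set A := (4 * (k + 3)) ^ ρ with hA
    have hA1 : 1 ≤ A := Nat.one_le_pow _ _ (by omega)
    have hDA : 2 ^ ρ ≤ A := Nat.pow_le_pow_left (by omega) ρ
    have hsA : (2 * (k + 2)) ^ ρ ≤ A := Nat.pow_le_pow_left (by omega) ρ
    have hkA : k + 2 ≤ A :=
      calc k + 2 ≤ 4 * (k + 3) := by omega
        _ ≤ A := Nat.le_self_pow (by omega) _
    have hAQ : A ≤ Q ^ A := (Nat.lt_two_pow_self).le.trans (Nat.pow_le_pow_left hQ2 A)
    have hP : 2 ^ ρ * A * (k + 2) * (2 * (k + 2)) ^ ρ * Q ^ ((2 * (k + 2)) ^ ρ) ≤ Q ^ (5 * A) := by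
      calc _ ≤ Q ^ A * Q ^ A * Q ^ A * Q ^ A * Q ^ A :=
            Nat.mul_le_mul (Nat.mul_le_mul (Nat.mul_le_mul (Nat.mul_le_mul (hDA.trans hAQ) hAQ)
              (hkA.trans hAQ)) (hsA.trans hAQ)) (Nat.pow_le_pow_right (by omega) hsA)
        _ = _ := by ring
    have hQ5 : Q ^ 2 ≤ Q ^ (5 * A) := Nat.pow_le_pow_right (by omega) (by omega)
    have h5 : t ≤ 80 * (n * 2 ^ ρ * Q ^ (5 * A)) := by
      have h6 := Nat.mul_le_mul_left (n * 2 ^ ρ) hP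
      have h7 := Nat.mul_le_mul hmle hQ5
      omega
    have h8 : ((Q ^ (5 * A) : ℕ) : ℝ) ≤ (Q : ℝ) ^ (dbRadius (dbPhi ε ρ) ρ ^ (2 * ρ)) := by
      rw [Nat.cast_pow, ← Real.rpow_natCast]
      refine Real.rpow_le_rpow_of_exponent_le (by exact_mod_cast (by omega : 1 ≤ Q)) ?_
      have := radius_pow_le h0 h1 hρ hk
      rw [hA]
      push_cast
      exact this
    calc (t : ℝ) ≤ 80 * (n * 2 ^ ρ * ((Q ^ (5 * A) : ℕ) : ℝ)) := by exact_mod_cast h5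
      _ ≤ _ := by gcongr

omit [NeZero q] in
/-- No edge is removed with large probability. -/
theorem dbDim_blue_le (h : doublingDim M.graph ≤ (ρ : ℕ∞)) (h0 : 0 < ε) (h1 : ε < 1)
    (hk : IsRounding k (dbRadius (dbPhi ε ρ) ρ)) {e : Fin n × Fin n}
    (he : e ∈ edgePairs M.graph) :
    (dbDim (edgeGraph M.graph) (dbPhi ε ρ) k (edgePairs M.graph)).toOuterMeasure {B | e ∈ B}
      ≤ ENNReal.ofReal (2 * dbPhi ε ρ) := by
  classical
  -- The edge `e` itself forces `ρ ≥ 1`, hence `k ≥ 1` and a genuine truncated geometric law.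
  have hρ : 1 ≤ ρ := by
    by_contra hρ
    have hρ0 : ρ = 0 := by omega
    subst hρ0
    have := card_lt_of_forall_adj h e.1 {e.2} (by simpa using (mem_edgePairs.1 he).2)
    simp at this
  have hφ0 := dbPhi_pos h0 ρ
  have hφ1 := dbPhi_le h1 hρ
  have hX := le_dbRadius_arg h0 h1 hρ
  have hK := le_dbRadius h0 h1 hρ
  obtain ⟨b1, b2⟩ := hk.bounds (by linarith)
  have hk1 : 1 ≤ k := by
    have : (0 : ℝ) < k := by linarith
    exact_mod_cast this
  refine (dbDimLoop_blue_le (edgeGraph M.graph) (dbPhi ε ρ) hφ0.le (by linarith) k hk1 e _ _ ∅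
    (by simp)).trans (ENNReal.ofReal_le_ofReal ?_)
  have hcard := card_edges_le_of_edist_le h he k
    ((edgePairs M.graph).filter fun x => (edgeGraph M.graph).edist x e = (k : ℕ∞)) fun f hf => by
      rw [SimpleGraph.edist_comm]
      exact (Finset.mem_filter.1 hf).2.le
  have hcard' : (((edgePairs M.graph).filter
      fun x => (edgeGraph M.graph).edist x e = (k : ℕ∞)).card : ℝ) ≤ (4 * ((k : ℝ) + 2)) ^ ρ := by
    exact_mod_cast hcard
  have := mul_le_mul_of_nonneg_left hcard'
    (pow_nonneg (by linarith : (0 : ℝ) ≤ 1 - dbPhi ε ρ) (k - 1))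
  have := truncation_le h0 h1 hρ hk
  linarith

theorem logPartition_gap (h : doublingDim M.graph ≤ (ρ : ℕ∞)) (h0 : 0 < ε) (h1 : ε < 1)
    (hk : IsRounding k (dbRadius (dbPhi ε ρ) ρ)) :
    Summable (fun b : ℝ × ℝ =>
      ((M.logPartition (dbPhi ε ρ) k).output b).toReal * (b.2 - b.1)) ∧
    ∑' b : ℝ × ℝ, ((M.logPartition (dbPhi ε ρ) k).output b).toReal * (b.2 - b.1)
      ≤ ε * Real.log M.partitionFn := by
  rw [logPartition_output]
  have hs := PMF.hasSum_map_mul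
    (dbDim (edgeGraph M.graph) (dbPhi ε ρ) k (edgePairs M.graph))
    (fun B => (M.logLowerBound B, M.logUpperBound B)) (fun b : ℝ × ℝ => b.2 - b.1)
  refine ⟨hs.summable, ?_⟩
  rw [hs.tsum_eq]
  have hφ0 := dbPhi_pos h0 ρ
  refine (M.expected_gap_le _ (fun B hB => dbDim_support_subset _ _ _ _ _ hB)
    (c := 2 * dbPhi ε ρ) (by positivity) (fun e he => M.dbDim_blue_le h h0 h1 hk he)
    (D := 2 ^ ρ) fun v s hs => (Nat.le_succ _).trans (card_lt_of_forall_adj h v s hs)).trans ?_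
  -- The choice of `φ` leaves a factor of two to spare.
  have e1 : 2 * dbPhi ε ρ * (2 * ((2 ^ ρ : ℕ) : ℝ) * Real.log M.partitionFn)
      = ε / 2 * Real.log M.partitionFn := by
    rw [dbPhi_eq]
    push_cast
    field_simp
    norm_num
  rw [e1]
  have := mul_nonneg h0.le M.log_partitionFn_nonneg
  linarith

end PairwiseMRF

/-- `x exp (c √(log x))` is of smaller order than `x ^ (1 + δ)`. -/
theorem isLittleO_mul_exp_sqrt_log (c : ℝ) {δ : ℝ} (hδ : 0 < δ) :
    (fun x : ℝ => x * Real.exp (c * √(Real.log x))) =o[Filter.atTop] fun x => x ^ (1 + δ) := by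
  have h1 : (fun x : ℝ => Real.exp (Real.log x + c * √(Real.log x))) =o[Filter.atTop]
      fun x => Real.exp (Real.log x * (1 + δ)) := by
    rw [Real.isLittleO_exp_comp_exp_comp]
    have hs : Filter.Tendsto (fun x => √(Real.log x)) Filter.atTop Filter.atTop :=
      Real.tendsto_sqrt_atTop.comp Real.tendsto_log_atTop
    -- This is the difference of the two exponents, `δ log x - c √(log x)`, in factored form.
    have h2 : Filter.Tendsto (fun x => √(Real.log x) * (δ * √(Real.log x) + -c)) Filter.atTop
        Filter.atTop :=
      hs.atTop_mul_atTop₀ (Filter.tendsto_atTop_add_const_right _ _ (hs.const_mul_atTop hδ))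
    refine h2.congr' ?_
    filter_upwards [Filter.eventually_ge_atTop 1] with x hx
    have := Real.mul_self_sqrt (Real.log_nonneg hx)
    linear_combination δ * this
  refine h1.congr' ?_ ?_
  · filter_upwards [Filter.eventually_gt_atTop 0] with x hx
    rw [Real.exp_add, Real.exp_log hx]
  · filter_upwards [Filter.eventually_gt_atTop 0] with x hx
    rw [Real.rpow_def_of_pos hx]

theorem PairwiseMRF.isLittleO_time (q : ℕ) [NeZero q] (n : ℕ → ℕ) (M : ∀ i, PairwiseMRF (n i) q)
    (ρ : ℕ → ℕ) (ε : ℕ → ℝ) (k : ℕ → ℕ) (hn : Filter.Tendsto n Filter.atTop Filter.atTop)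
    (hρ : ∀ i, doublingDim (M i).graph ≤ (ρ i : ℕ∞)) (hε : ∀ i, 0 < ε i ∧ ε i < 1)
    (hk : ∀ i, IsRounding (k i) (dbRadius (dbPhi (ε i) (ρ i)) (ρ i)))
    (hlog : (fun i => (ρ i : ℝ) * (ρ i + Real.log (1 / ε i))) =o[Filter.atTop]
      (fun i => Real.log (Real.log (n i))))
    (δ : ℝ) (hδ : 0 < δ) (T : ℕ → ℕ)
    (hT : ∀ i, T i ∈ ((M i).logPartition (dbPhi (ε i) (ρ i)) (k i)).runningTimes) :
    (fun i => (T i : ℝ)) =o[Filter.atTop] (fun i => (n i : ℝ) ^ (1 + δ)) := by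
  set Q := max q 2 with hQ
  have hQ2 : (2 : ℝ) ≤ (Q : ℝ) := by exact_mod_cast le_max_right q 2
  have hn' : Filter.Tendsto (fun i => (n i : ℝ)) Filter.atTop Filter.atTop :=
    tendsto_natCast_atTop_atTop.comp hn
  have hll : Filter.Tendsto (fun i => Real.log (Real.log (n i))) Filter.atTop Filter.atTop :=
    Real.tendsto_log_atTop.comp (Real.tendsto_log_atTop.comp hn')
  refine Asymptotics.IsBigO.trans_isLittleO ?_
    ((isLittleO_mul_exp_sqrt_log (2 * Real.log Q) hδ).comp_tendsto hn')
  refine Asymptotics.IsBigO.of_bound 80 ?_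
  -- With `1 / 64` the constant `32` of `radius_pow_le_exp` becomes `1 / 2`, so the exponent of the
  -- running time is at most `(log n) ^ (1 / 2)`.
  filter_upwards [hlog.bound (show (0 : ℝ) < 1 / 64 by norm_num), hll.eventually_ge_atTop 0,
    hn.eventually_ge_atTop 2] with i hi1 hi2 hi3
  obtain ⟨h0, h1⟩ := hε i
  have ht := (M i).logPartition_time_le_rpow (by omega) (hρ i) h0 h1 (hk i) (hT i)
  set Y := dbRadius (dbPhi (ε i) (ρ i)) (ρ i) ^ (2 * ρ i) with hY
  have hl0 : 0 < Real.log (n i) := Real.log_pos (by exact_mod_cast hi3)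
  have hYs : Y ≤ √(Real.log (n i)) := by
    refine (radius_pow_le_exp h0 h1).trans ?_
    rw [Real.norm_of_nonneg hi2] at hi1
    rw [Real.sqrt_eq_rpow, Real.rpow_def_of_pos hl0, Real.exp_le_exp]
    have := (Real.le_norm_self _).trans hi1
    linarith
  have hρY : (ρ i : ℝ) ≤ Y := natCast_le_radius_pow h0 h1
  rw [Real.norm_of_nonneg (Nat.cast_nonneg _), Function.comp_apply,
    Real.norm_of_nonneg (by positivity)]
  have e1 : (2 : ℝ) ^ ρ i ≤ (Q : ℝ) ^ Y := by
    calc (2 : ℝ) ^ ρ i ≤ (Q : ℝ) ^ ρ i := pow_le_pow_left₀ (by norm_num) hQ2 _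
      _ = (Q : ℝ) ^ (ρ i : ℝ) := (Real.rpow_natCast _ _).symm
      _ ≤ _ := Real.rpow_le_rpow_of_exponent_le (by linarith) hρY
  have e2 : (Q : ℝ) ^ Y * (Q : ℝ) ^ Y ≤ Real.exp (2 * Real.log Q * √(Real.log (n i))) := by
    rw [← Real.rpow_add (by linarith), Real.rpow_def_of_pos (by linarith), Real.exp_le_exp]
    have := mul_le_mul_of_nonneg_left hYs (Real.log_nonneg (by linarith : (1 : ℝ) ≤ Q))
    linarith
  calc (T i : ℝ) ≤ 80 * (n i * 2 ^ ρ i * (Q : ℝ) ^ Y) := ht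
    _ ≤ 80 * (n i * (Q : ℝ) ^ Y * (Q : ℝ) ^ Y) := by gcongr
    _ = 80 * (n i * ((Q : ℝ) ^ Y * (Q : ℝ) ^ Y)) := by ring
    _ ≤ _ := by gcongr

theorem mainTheorem1 :
    (∃ C : ℝ, 0 < C ∧
      ∀ (n q : ℕ) [NeZero q] (M : PairwiseMRF n q) (ρ : ℕ) (ε : ℝ) (k : ℕ),
        1 ≤ n → doublingDim M.graph ≤ (ρ : ℕ∞) → 0 < ε → ε < 1 →
        IsRounding k (dbRadius (dbPhi ε ρ) ρ) →
        (M.logPartition (dbPhi ε ρ) k).output =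
            (dbDim (edgeGraph M.graph) (dbPhi ε ρ) k (edgePairs M.graph)).map
              (fun B => (M.logLowerBound B, M.logUpperBound B)) ∧
        (∀ b ∈ (M.logPartition (dbPhi ε ρ) k).output.support,
          b.1 ≤ Real.log M.partitionFn ∧ Real.log M.partitionFn ≤ b.2) ∧
        (Summable (fun b : ℝ × ℝ =>
            ((M.logPartition (dbPhi ε ρ) k).output b).toReal * (b.2 - b.1)) ∧
          ∑' b : ℝ × ℝ, ((M.logPartition (dbPhi ε ρ) k).output b).toReal * (b.2 - b.1)
            ≤ ε * Real.log M.partitionFn) ∧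
        (2 ≤ q → ∀ t ∈ (M.logPartition (dbPhi ε ρ) k).runningTimes,
          (t : ℝ) ≤ C * (n * 2 ^ ρ * (q : ℝ) ^ (dbRadius (dbPhi ε ρ) ρ ^ (2 * ρ))))) ∧
    (∀ (q : ℕ) [NeZero q] (n : ℕ → ℕ) (M : ∀ i, PairwiseMRF (n i) q) (ρ : ℕ → ℕ) (ε : ℕ → ℝ)
        (k : ℕ → ℕ),
        Filter.Tendsto n Filter.atTop Filter.atTop →
        (∀ i, doublingDim (M i).graph ≤ (ρ i : ℕ∞)) →
        (∀ i, 0 < ε i ∧ ε i < 1) →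
        (∀ i, IsRounding (k i) (dbRadius (dbPhi (ε i) (ρ i)) (ρ i))) →
        (fun i => (ρ i : ℝ) * (ρ i + Real.log (1 / ε i))) =o[Filter.atTop]
          (fun i => Real.log (Real.log (n i))) →
        ∀ δ : ℝ, 0 < δ → ∀ T : ℕ → ℕ,
          (∀ i, T i ∈ ((M i).logPartition (dbPhi (ε i) (ρ i)) (k i)).runningTimes) →
          (fun i => (T i : ℝ)) =o[Filter.atTop] (fun i => (n i : ℝ) ^ (1 + δ))) := by
  refine ⟨⟨80, by norm_num, ?_⟩, ?_⟩
  · intro n q _ M ρ ε k hn hρ h0 h1 hk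
    refine ⟨M.logPartition_output _ _, ?_, M.logPartition_gap hρ h0 h1 hk, ?_⟩
    · intro b hb
      rw [M.logPartition_output, PMF.mem_support_map_iff] at hb
      obtain ⟨B, hB, rfl⟩ := hb
      have hBE := dbDim_support_subset _ _ _ _ _ hB
      exact ⟨M.logLowerBound_le hBE, M.le_logUpperBound hBE⟩
    · intro hq t ht
      have := M.logPartition_time_le_rpow hn hρ h0 h1 hk ht
      rwa [max_eq_left hq] at this
  · intro q _ n M ρ ε k hn hρ hε hk hlog δ hδ T hT
    exact PairwiseMRF.isLittleO_time q n M ρ ε k hn hρ hε hk hlog δ hδ T hT
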